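/- For a commutative ring $A$ let $W(A)=1+T\,A[[T]]$ be the big Witt ring: its addition is the multiplication of power series (so its zero element is $1$), its multiplication is the Witt multiplication, i.e. the functorial, $T$-adically continuous one with $(1-aT)*(1-bT)=1-abT$ (so its unit element is $1-T$). Let $$W_{\mathrm{rat}}(A)=\{f\in W(A)\mid fQ=P \text{ for some } P,Q\in A[T],\ P(0)=Q(0)=1\},$$ $$W_J(A)=\{f\in W(A)\mid \exists\, r\ge 1:\ \text{all } (r+1)\times(r+1)\text{-minors of } H(f) \text{ vanish}\},$$ where $H(f)=(a_{i+j})_{i,j\ge 0}$ is the infinite Hankel matrix of $f=1+a_1T+a_2T^2+\cdots$ with $a_0=1$. For a scheme $X$ put $W_{\mathrm{rat}}(\mathcal O)(X)=W_{\mathrm{rat}}(\mathcal O(X))$ and $W_J(\mathcal O)(X)=W_J(\mathcal O(X))$. Theorem. (1) On the category of Noetherian affine schemes, $W_{\mathrm{rat}}(\mathcal O)\subset W_J(\mathcal O)$ are presheaves of subrings of $X\mapsto W(\mathcal O(X))$. (2) Both satisfy the sheaf condition for fpqc coverings of Noetherian affine schemes: let $P$ be $W_{\mathrm{rat}}(\mathcal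 O)$ or $W_J(\mathcal O)$, and let $\{U_i\to X\}_{i\in I}$ be an fpqc covering (a jointly surjective, quasi-compact family of flat morphisms) with $X$ and all $U_i$ affine and Noetherian. Then the sequence $$P(X)\to\prod_i P(U_i)\rightrightarrows\prod_{i,j}P(U_i\times_X U_j)$$ is exact, i.e. $P(X)$ is mapped bijectively onto the equalizer. (The affine schemes $U_i\times_X U_j$ need not be Noetherian.) (3) If $X$ is an integral Noetherian affine scheme, then $W_{\mathrm{rat}}(\mathcal O(X))=W_J(\mathcal O(X))$. (4) For $X=\operatorname{Spec}\mathbb F_2[\varepsilon]$ with $\varepsilon^2=0$ one has $W_{\mathrm{rat}}(\mathcal O(X))\ne W_J(\mathcal O(X))$; indeed $W_{\mathrm{rat}}(\mathcal O(X))$ is countable and $W_J(\mathcal O(X))$ is uncountable. -/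

import Mathlib

open CategoryTheory AlgebraicGeometry Opposite

universe u v

/-! ### Congruences and logarithmic derivatives of power series -/

namespace BigWitt

open PowerSeries

section Aux

variable {A B : Type*} [CommRing A] [CommRing B]

/-- The inverse of a power series with constant coefficient `1`. -/
noncomputable def inv1 (f : A⟦X⟧) : A⟦X⟧ := invOfUnit f 1

lemma mul_inv1 {f : A⟦X⟧} (hf : constantCoeff f = 1) : f * inv1 f = 1 :=
  mul_invOfUnit f 1 (by simpa using hf)

lemma constantCoeff_inv1 (f : A⟦X⟧) : constantCoeff (inv1 f) = 1 := by
  simp [inv1, constantCoeff_invOfUnit]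

lemma eq_inv1 {f g : A⟦X⟧} (hf : constantCoeff f = 1) (h : f * g = 1) : g = inv1 f := by
  calc g = (f * inv1 f) * g := by rw [mul_inv1 hf, one_mul]
    _ = inv1 f * (f * g) := by ring
    _ = inv1 f := by rw [h, mul_one]

lemma constantCoeff_map_one (φ : A →+* B) {f : A⟦X⟧} (hf : constantCoeff f = 1) :
    constantCoeff (PowerSeries.map φ f) = 1 := by
  rw [← coeff_zero_eq_constantCoeff_apply, coeff_map, coeff_zero_eq_constantCoeff_apply, hf,
    map_one]

lemma map_inv1 (φ : A →+* B) {f : A⟦X⟧} (hf : constantCoeff f = 1) :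
    PowerSeries.map φ (inv1 f) = inv1 (PowerSeries.map φ f) :=
  eq_inv1 (constantCoeff_map_one φ hf) (by rw [← map_mul, mul_inv1 hf, map_one])

/-- Reduction of power series modulo `X ^ N`. -/
noncomputable abbrev modX (A : Type*) [CommRing A] (N : ℕ) :
    A⟦X⟧ →+* A⟦X⟧ ⧸ Ideal.span {(X : A⟦X⟧) ^ N} :=
  Ideal.Quotient.mk _

lemma modX_eq_iff {N : ℕ} {f g : A⟦X⟧} :
    modX A N f = modX A N g ↔ ∀ m < N, coeff m f = coeff m g := by
  rw [Ideal.Quotient.mk_eq_mk_iff_sub_mem, Ideal.mem_span_singleton, X_pow_dvd_iff]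
  simp [sub_eq_zero]

lemma constantCoeff_one_sub {n : ℕ} (hn : n ≠ 0) (a : A) :
    constantCoeff (1 - C a * X ^ n) = 1 := by
  simp [hn]

lemma modX_one_sub {N n : ℕ} (h : N ≤ n) (a : A) : modX A N (1 - C a * X ^ n) = 1 := by
  rw [← map_one (modX A N), modX_eq_iff]
  intro m hm
  have : m ≠ n := by omega
  simp [coeff_X_pow, this]

/-- The power series `- f' / f`, whose coefficient of `X ^ r` is the ghost component of index
`r + 1` of `f`. -/
noncomputable def ghost (f : A⟦X⟧) : A⟦X⟧ := -(derivative A f * inv1 f)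

lemma ghost_eq {f h : A⟦X⟧} (hf : constantCoeff f = 1) (hd : derivative A f = -(h * f)) :
    ghost f = h := by
  rw [ghost, hd]
  calc -(-(h * f) * inv1 f) = h * (f * inv1 f) := by ring
    _ = h := by rw [mul_inv1 hf, mul_one]

lemma derivative_eq {f : A⟦X⟧} (hf : constantCoeff f = 1) :
    derivative A f = -(ghost f * f) := by
  rw [ghost]
  calc derivative A f = derivative A f * (f * inv1 f) := by rw [mul_inv1 hf, mul_one]
    _ = _ := by ring

lemma ghost_one : ghost (1 : A⟦X⟧) = 0 := by simp [ghost]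

lemma ghost_mul {f g : A⟦X⟧} (hf : constantCoeff f = 1) (hg : constantCoeff g = 1) :
    ghost (f * g) = ghost f + ghost g := by
  apply ghost_eq (by simp [hf, hg])
  rw [Derivation.leibniz, derivative_eq hf, derivative_eq hg]
  simp only [smul_eq_mul]
  ring

lemma ghost_prod {ι : Type*} (s : Finset ι) (f : ι → A⟦X⟧)
    (hf : ∀ i ∈ s, constantCoeff (f i) = 1) :
    ghost (∏ i ∈ s, f i) = ∑ i ∈ s, ghost (f i) := by
  classical
  induction s using Finset.induction_on with
  | empty => simp [ghost_one]
  | insert i s hi ih =>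
    rw [Finset.prod_insert hi, Finset.sum_insert hi, ghost_mul (hf i (by simp)), ih]
    · intro j hj
      exact hf j (by simp [hj])
    · rw [map_prod]
      exact Finset.prod_eq_one fun j hj => hf j (by simp [hj])

lemma ghost_pow {f : A⟦X⟧} (hf : constantCoeff f = 1) (n : ℕ) :
    ghost (f ^ n) = n • ghost f := by
  have := ghost_prod (Finset.range n) (fun _ => f) (fun _ _ => hf)
  simpa using this

lemma coeff_ghost_one_sub {n : ℕ} (hn : n ≠ 0) (a : A) (r : ℕ) :
    coeff r (ghost (1 - C a * X ^ n)) =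
      if n ∣ r + 1 then (n : A) * a ^ ((r + 1) / n) else 0 := by
  rw [ghost_eq (h := PowerSeries.mk fun r =>
    if n ∣ r + 1 then (n : A) * a ^ ((r + 1) / n) else 0) (constantCoeff_one_sub hn a), coeff_mk]
  ext r
  rw [mul_sub, mul_one, coeff_derivative, map_sub, map_neg, map_sub, coeff_mk, mul_left_comm,
    coeff_C_mul, coeff_C_mul, coeff_mul_X_pow', coeff_X_pow, coeff_one, coeff_mk]
  have h0 : r + 1 ≠ 0 := by omega
  rw [if_neg h0]
  rcases lt_trichotomy (r + 1) n with h | h | h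
  · have h1 : ¬ n ∣ r + 1 := fun hd => absurd (Nat.le_of_dvd (by omega) hd) (by omega)
    have h2 : r + 1 ≠ n := by omega
    have h3 : ¬ n ≤ r := by omega
    simp [h1, h2, h3]
  · subst h
    simp
    ring
  · have h2 : r + 1 ≠ n := by omega
    have h3 : n ≤ r := by omega
    have h4 : r + 1 = (r - n + 1) + n := by omega
    have h5 : n ∣ r + 1 ↔ n ∣ r - n + 1 := by
      rw [h4]
      simp
    have h6 : (r + 1) / n = (r - n + 1) / n + 1 := by
      rw [h4, Nat.add_div_right _ (Nat.pos_of_ne_zero hn)]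
    simp only [h2, h3, h5, h6, if_true, if_false]
    split_ifs <;> ring

lemma coeff_ghost_eq_zero {r : ℕ} {u : A⟦X⟧} (h : modX A (r + 2) u = 1) :
    coeff r (ghost u) = 0 := by
  rw [← map_one (modX A (r + 2)), modX_eq_iff] at h
  have h1 : (X : A⟦X⟧) ^ (r + 1) ∣ derivative A u := by
    rw [X_pow_dvd_iff]
    intro m hm
    rw [coeff_derivative, h (m + 1) (by omega), coeff_one, if_neg (by omega), zero_mul]
  have h2 : (X : A⟦X⟧) ^ (r + 1) ∣ ghost u := by
    rw [ghost, dvd_neg]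
    exact h1.mul_right _
  exact X_pow_dvd_iff.mp h2 r (by omega)

lemma coeff_ghost_congr {r : ℕ} {f g : A⟦X⟧} (hf : constantCoeff f = 1)
    (hg : constantCoeff g = 1) (h : modX A (r + 2) f = modX A (r + 2) g) :
    coeff r (ghost f) = coeff r (ghost g) := by
  have h1 : f = g * (f * inv1 g) := by
    calc f = f * (g * inv1 g) := by rw [mul_inv1 hg, mul_one]
      _ = _ := by ring
  have h2 : constantCoeff (f * inv1 g) = 1 := by simp [hf, constantCoeff_inv1]
  rw [h1, ghost_mul hg h2, map_add, coeff_ghost_eq_zero (u := f * inv1 g), add_zero]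
  rw [map_mul, h, ← map_mul, mul_inv1 hg, map_one]

lemma ghost_injective [IsAddTorsionFree A] {f g : A⟦X⟧} (hf : constantCoeff f = 1)
    (hg : constantCoeff g = 1) (h : ghost f = ghost g) : f = g := by
  have h2 : constantCoeff (f * inv1 g) = 1 := by simp [hf, constantCoeff_inv1]
  have h1 : f = g * (f * inv1 g) := by
    calc f = f * (g * inv1 g) := by rw [mul_inv1 hg, mul_one]
      _ = _ := by ring
  have h3 : ghost (f * inv1 g) = 0 := by
    have := ghost_mul hg h2
    rw [← h1, h] at this
    simpa using this
  have h4 : f * inv1 g = 1 := by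
    apply derivative.ext
    · rw [derivative_eq h2, h3]
      simp
    · simp [h2]
  rw [h1, h4, mul_one]

end Aux

/-! ### The Witt product of power series -/

section Mul

variable {A B : Type*} [CommRing A] [CommRing B]

/-- `wittRem f n` is what remains of `f = ∏_{i ≥ 1} (1 - aᵢ Xⁱ)` after removing the first `n`
factors. -/
noncomputable def wittRem (f : A⟦X⟧) : ℕ → A⟦X⟧
  | 0 => f
  | n + 1 => wittRem f n * inv1 (1 - C (-coeff (n + 1) (wittRem f n)) * X ^ (n + 1))

/-- The Witt coordinates of a power series `f` with constant coefficient `1`, that is, the elements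
`aᵢ` with `f = ∏_{i ≥ 1} (1 - aᵢ Xⁱ)`; here `wittCoord f n` is `aₙ₊₁`. -/
noncomputable def wittCoord (f : A⟦X⟧) (n : ℕ) : A := -coeff (n + 1) (wittRem f n)

/-- The Witt product `(1 - a Xⁿ) * (1 - b Xᵐ) = (1 - a^(l/n) b^(l/m) Xˡ)^d` of two elementary
factors, where `l` is the least common multiple and `d` the greatest common divisor of `n`
and `m`. -/
noncomputable def wittMulFactor (n m : ℕ) (a b : A) : A⟦X⟧ :=
  (1 - C (a ^ (n.lcm m / n) * b ^ (n.lcm m / m)) * X ^ n.lcm m) ^ n.gcd m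

/-- The Witt product of `∏_{i ≤ K} (1 - aᵢ Xⁱ)` and `∏_{j ≤ K} (1 - bⱼ Xʲ)` for the Witt coordinates
`aᵢ` of `f` and `bⱼ` of `g`. -/
noncomputable def wittMulApprox (f g : A⟦X⟧) (K : ℕ) : A⟦X⟧ :=
  ∏ i ∈ Finset.range K, ∏ j ∈ Finset.range K,
    wittMulFactor (i + 1) (j + 1) (wittCoord f i) (wittCoord g j)

/-- The Witt product of two power series with constant coefficient `1`: if
`f = ∏ (1 - aᵢ Xⁱ)` and `g = ∏ (1 - bⱼ Xʲ)`, it is the infinite product over all `i, j` of the Witt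
products of `1 - aᵢ Xⁱ` and `1 - bⱼ Xʲ`. Only the factors with `i, j ≤ k` affect the coefficient
of `Xᵏ`. -/
noncomputable def wittMul (f g : A⟦X⟧) : A⟦X⟧ :=
  PowerSeries.mk fun k => coeff k (wittMulApprox f g k)

lemma constantCoeff_wittRem {f : A⟦X⟧} (hf : constantCoeff f = 1) (n : ℕ) :
    constantCoeff (wittRem f n) = 1 := by
  induction n with
  | zero => exact hf
  | succ n ih => rw [wittRem, map_mul, ih, constantCoeff_inv1, one_mul]

lemma wittRem_succ_mul (f : A⟦X⟧) (n : ℕ) :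
    wittRem f (n + 1) * (1 - C (wittCoord f n) * X ^ (n + 1)) = wittRem f n := by
  rw [wittRem, wittCoord, mul_assoc, mul_comm (inv1 _),
    mul_inv1 (constantCoeff_one_sub (by omega) _), mul_one]

lemma wittRem_mul_prod (f : A⟦X⟧) (K : ℕ) :
    wittRem f K * ∏ i ∈ Finset.range K, (1 - C (wittCoord f i) * X ^ (i + 1)) = f := by
  induction K with
  | zero => simp [wittRem]
  | succ K ih =>
    rw [Finset.prod_range_succ, mul_comm (Finset.prod _ _), ← mul_assoc, wittRem_succ_mul, ih]

lemma modX_wittRem {f : A⟦X⟧} (hf : constantCoeff f = 1) (K : ℕ) :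
    modX A (K + 1) (wittRem f K) = 1 := by
  induction K with
  | zero =>
    rw [← map_one (modX A _), modX_eq_iff]
    intro m hm
    obtain rfl : m = 0 := by omega
    simpa [wittRem] using hf
  | succ K ih =>
    have h1 : modX A (K + 1 + 1) (wittRem f K) =
        modX A (K + 1 + 1) (1 - C (wittCoord f K) * X ^ (K + 1)) := by
      rw [← map_one (modX A _), modX_eq_iff] at ih
      rw [modX_eq_iff]
      intro m hm
      rcases Nat.lt_succ_iff_lt_or_eq.mp hm with h | rfl
      · have : m ≠ K + 1 := by omega
        simp [ih m h, coeff_X_pow, this]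
      · simp [wittCoord, coeff_one]
    rw [wittRem, map_mul, h1, ← map_mul, wittCoord,
      mul_inv1 (constantCoeff_one_sub (by omega) _), map_one]

lemma coeff_ghost_eq_sum {f : A⟦X⟧} (hf : constantCoeff f = 1) {r K : ℕ} (hK : r + 1 ≤ K) :
    coeff r (ghost f) = ∑ i ∈ Finset.range K,
      if i + 1 ∣ r + 1 then ((i + 1 : ℕ) : A) * wittCoord f i ^ ((r + 1) / (i + 1)) else 0 := by
  have h1 : ∀ i ∈ Finset.range K,
      constantCoeff (1 - C (wittCoord f i) * X ^ (i + 1)) = 1 :=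
    fun i _ => constantCoeff_one_sub (by omega) _
  have h2 : constantCoeff (∏ i ∈ Finset.range K, (1 - C (wittCoord f i) * X ^ (i + 1))) = 1 := by
    rw [map_prod]
    exact Finset.prod_eq_one h1
  conv_lhs => rw [← wittRem_mul_prod f K]
  rw [ghost_mul (constantCoeff_wittRem hf K) h2, map_add, coeff_ghost_eq_zero, zero_add,
    ghost_prod _ _ h1, map_sum]
  · exact Finset.sum_congr rfl fun i _ => coeff_ghost_one_sub (by omega) _ _
  · have := modX_wittRem hf K
    rw [← map_one (modX A _), modX_eq_iff] at this ⊢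
    exact fun m hm => this m (by omega)

lemma constantCoeff_wittMulFactor {n m : ℕ} (hn : n ≠ 0) (hm : m ≠ 0) (a b : A) :
    constantCoeff (wittMulFactor n m a b) = 1 := by
  rw [wittMulFactor, map_pow, constantCoeff_one_sub (Nat.lcm_ne_zero hn hm), one_pow]

lemma modX_wittMulFactor {N n m : ℕ} (h : N ≤ n.lcm m) (a b : A) :
    modX A N (wittMulFactor n m a b) = 1 := by
  rw [wittMulFactor, map_pow, modX_one_sub h, one_pow]

lemma coeff_ghost_wittMulFactor {n m : ℕ} (hn : n ≠ 0) (hm : m ≠ 0) (a b : A) (r : ℕ) :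
    coeff r (ghost (wittMulFactor n m a b)) =
      (if n ∣ r + 1 then (n : A) * a ^ ((r + 1) / n) else 0) *
        (if m ∣ r + 1 then (m : A) * b ^ ((r + 1) / m) else 0) := by
  have hl := Nat.lcm_ne_zero hn hm
  rw [wittMulFactor, ghost_pow (constantCoeff_one_sub hl _), map_nsmul,
    coeff_ghost_one_sub hl, nsmul_eq_mul]
  by_cases h : n.lcm m ∣ r + 1
  · have h1 : n ∣ r + 1 := (Nat.dvd_lcm_left n m).trans h
    have h2 : m ∣ r + 1 := (Nat.dvd_lcm_right n m).trans h
    rw [if_pos h, if_pos h1, if_pos h2, mul_pow, ← pow_mul, ← pow_mul,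
      ← Nat.mul_div_right_comm (Nat.dvd_lcm_left n m),
      ← Nat.mul_div_right_comm (Nat.dvd_lcm_right n m),
      Nat.mul_div_cancel' h]
    have h3 : ((n.gcd m : ℕ) : A) * ((n.lcm m : ℕ) : A) = (n : A) * (m : A) := by
      exact_mod_cast congrArg (Nat.cast (R := A)) (Nat.gcd_mul_lcm n m)
    linear_combination (a ^ ((r + 1) / n) * b ^ ((r + 1) / m)) * h3
  · rw [if_neg h, mul_zero]
    by_cases h1 : n ∣ r + 1
    · have h2 : ¬ m ∣ r + 1 := fun h2 => h (Nat.lcm_dvd h1 h2)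
      rw [if_neg h2, mul_zero]
    · rw [if_neg h1, zero_mul]

lemma constantCoeff_wittMulApprox (f g : A⟦X⟧) (K : ℕ) :
    constantCoeff (wittMulApprox f g K) = 1 := by
  rw [wittMulApprox, map_prod]
  refine Finset.prod_eq_one fun i _ => ?_
  rw [map_prod]
  exact Finset.prod_eq_one fun j _ => constantCoeff_wittMulFactor (by omega) (by omega) _ _

lemma modX_wittMulApprox_succ (f g : A⟦X⟧) (K : ℕ) :
    modX A (K + 1) (wittMulApprox f g (K + 1)) = modX A (K + 1) (wittMulApprox f g K) := by
  have h1 (i : ℕ) : modX A (K + 1)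
      (wittMulFactor (i + 1) (K + 1) (wittCoord f i) (wittCoord g K)) = 1 :=
    modX_wittMulFactor
      (Nat.le_of_dvd (Nat.lcm_pos (by omega) (by omega)) (Nat.dvd_lcm_right _ _)) _ _
  have h2 (j : ℕ) : modX A (K + 1)
      (wittMulFactor (K + 1) (j + 1) (wittCoord f K) (wittCoord g j)) = 1 :=
    modX_wittMulFactor
      (Nat.le_of_dvd (Nat.lcm_pos (by omega) (by omega)) (Nat.dvd_lcm_left _ _)) _ _
  simp only [wittMulApprox, Finset.prod_range_succ, map_mul, map_prod, h1, h2, mul_one,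
    Finset.prod_const_one]

lemma coeff_wittMulApprox (f g : A⟦X⟧) {m K : ℕ} (h : m ≤ K) :
    coeff m (wittMulApprox f g K) = coeff m (wittMul f g) := by
  rw [wittMul, coeff_mk]
  induction K, h using Nat.le_induction with
  | base => rfl
  | succ K hK ih => rw [modX_eq_iff.mp (modX_wittMulApprox_succ f g K) m (by omega), ih]

lemma constantCoeff_wittMul (f g : A⟦X⟧) : constantCoeff (wittMul f g) = 1 := by
  rw [← coeff_zero_eq_constantCoeff_apply, ← coeff_wittMulApprox f g le_rfl,
    coeff_zero_eq_constantCoeff_apply, constantCoeff_wittMulApprox]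

/-- Ghost components turn the Witt product into the ordinary product. -/
lemma coeff_ghost_wittMul {f g : A⟦X⟧} (hf : constantCoeff f = 1) (hg : constantCoeff g = 1)
    (r : ℕ) : coeff r (ghost (wittMul f g)) = coeff r (ghost f) * coeff r (ghost g) := by
  have h1 : modX A (r + 2) (wittMul f g) = modX A (r + 2) (wittMulApprox f g (r + 2)) := by
    rw [modX_eq_iff]
    exact fun m hm => (coeff_wittMulApprox f g (by omega)).symm
  rw [coeff_ghost_congr (constantCoeff_wittMul f g) (constantCoeff_wittMulApprox f g _) h1,
    coeff_ghost_eq_sum hf (K := r + 2) (by omega), coeff_ghost_eq_sum hg (K := r + 2) (by omega),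
    Finset.sum_mul_sum, wittMulApprox, ghost_prod, map_sum]
  · refine Finset.sum_congr rfl fun i _ => ?_
    rw [ghost_prod, map_sum]
    · exact Finset.sum_congr rfl fun j _ =>
        coeff_ghost_wittMulFactor (by omega) (by omega) _ _ _
    · exact fun j _ => constantCoeff_wittMulFactor (by omega) (by omega) _ _
  · intro i _
    rw [map_prod]
    exact Finset.prod_eq_one fun j _ => constantCoeff_wittMulFactor (by omega) (by omega) _ _

lemma map_wittRem (φ : A →+* B) (f : A⟦X⟧) (n : ℕ) :
    PowerSeries.map φ (wittRem f n) = wittRem (PowerSeries.map φ f) n := by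
  induction n with
  | zero => rfl
  | succ n ih =>
    rw [wittRem, wittRem, map_mul, map_inv1 φ (constantCoeff_one_sub (by omega) _), ← ih]
    simp

lemma map_wittCoord (φ : A →+* B) (f : A⟦X⟧) (n : ℕ) :
    φ (wittCoord f n) = wittCoord (PowerSeries.map φ f) n := by
  rw [wittCoord, wittCoord, ← map_wittRem, coeff_map, map_neg]

lemma map_wittMul (φ : A →+* B) (f g : A⟦X⟧) :
    PowerSeries.map φ (wittMul f g) = wittMul (PowerSeries.map φ f) (PowerSeries.map φ g) := by
  ext k
  rw [coeff_map, wittMul, wittMul, coeff_mk, coeff_mk, ← coeff_map]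
  have h (n m : ℕ) (a b : A) : PowerSeries.map φ (wittMulFactor n m a b) =
      wittMulFactor n m (φ a) (φ b) := by
    simp [wittMulFactor]
  simp only [wittMulApprox, map_prod, h, map_wittCoord]

end Mul

end BigWitt

/-! ### The big Witt ring -/

/-- The underlying set `1 + T A[[T]]` of the big Witt ring `W(A)`. -/
@[ext]
structure BigWitt (A : Type*) [CommRing A] where
  /-- The power series. -/
  series : PowerSeries A
  constantCoeff_series : PowerSeries.constantCoeff series = 1

namespace BigWitt

open PowerSeries

section Ring

variable {A B : Type*} [CommRing A] [CommRing B]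

/-- Witt addition is the product of power series. -/
noncomputable instance : Add (BigWitt A) :=
  ⟨fun f g => ⟨f.series * g.series, by
    rw [map_mul, f.constantCoeff_series, g.constantCoeff_series, one_mul]⟩⟩

/-- The zero element is the power series `1`. -/
noncomputable instance : Zero (BigWitt A) := ⟨⟨1, map_one _⟩⟩

/-- The negative is the inverse power series. -/
noncomputable instance : Neg (BigWitt A) := ⟨fun f => ⟨inv1 f.series, constantCoeff_inv1 _⟩⟩

/-- Witt multiplication. -/
noncomputable instance : Mul (BigWitt A) :=
  ⟨fun f g => ⟨wittMul f.series g.series, constantCoeff_wittMul _ _⟩⟩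

/-- The unit element is `1 - T`. -/
noncomputable instance : One (BigWitt A) := ⟨⟨1 - X, by simp⟩⟩

lemma series_add (f g : BigWitt A) : (f + g).series = f.series * g.series := rfl

lemma series_zero : (0 : BigWitt A).series = 1 := rfl

lemma series_neg (f : BigWitt A) : (-f).series = inv1 f.series := rfl

lemma series_mul (f g : BigWitt A) : (f * g).series = wittMul f.series g.series := rfl

lemma series_one : (1 : BigWitt A).series = 1 - X := rfl

/-- The map `W(A) → W(B)` applying a ring homomorphism `φ : A → B` to the coefficients. -/
noncomputable def mapFun (φ : A →+* B) (f : BigWitt A) : BigWitt B :=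
  ⟨PowerSeries.map φ f.series, constantCoeff_map_one φ f.constantCoeff_series⟩

lemma mapFun_add (φ : A →+* B) (f g : BigWitt A) :
    mapFun φ (f + g) = mapFun φ f + mapFun φ g :=
  BigWitt.ext (map_mul (PowerSeries.map φ) f.series g.series)

lemma mapFun_zero (φ : A →+* B) : mapFun φ 0 = 0 :=
  BigWitt.ext (map_one (PowerSeries.map φ))

lemma mapFun_mul (φ : A →+* B) (f g : BigWitt A) :
    mapFun φ (f * g) = mapFun φ f * mapFun φ g :=
  BigWitt.ext (map_wittMul φ f.series g.series)

lemma mapFun_one (φ : A →+* B) : mapFun φ 1 = 1 :=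
  BigWitt.ext (by simp [mapFun, series_one])

lemma mapFun_surjective {φ : A →+* B} (hφ : Function.Surjective φ) :
    Function.Surjective (mapFun φ) := by
  intro g
  choose s hs using hφ
  refine ⟨⟨PowerSeries.mk fun n => if n = 0 then 1 else s (coeff n g.series), ?_⟩, ?_⟩
  · rw [← coeff_zero_eq_constantCoeff_apply, coeff_mk, if_pos rfl]
  · refine BigWitt.ext (PowerSeries.ext fun n => ?_)
    simp only [mapFun, coeff_map, coeff_mk]
    split_ifs with h
    · subst h
      rw [map_one, coeff_zero_eq_constantCoeff_apply, g.constantCoeff_series]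
    · exact hs _

lemma ext_ghost [IsAddTorsionFree A] {f g : BigWitt A}
    (h : ∀ r, coeff r (ghost f.series) = coeff r (ghost g.series)) : f = g :=
  BigWitt.ext (ghost_injective f.constantCoeff_series g.constantCoeff_series
    (PowerSeries.ext h))

lemma coeff_ghost_add (f g : BigWitt A) (r : ℕ) : coeff r (ghost (f + g).series) =
    coeff r (ghost f.series) + coeff r (ghost g.series) := by
  rw [series_add, ghost_mul f.constantCoeff_series g.constantCoeff_series, map_add]

lemma coeff_ghost_mul (f g : BigWitt A) (r : ℕ) : coeff r (ghost (f * g).series) =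
    coeff r (ghost f.series) * coeff r (ghost g.series) :=
  coeff_ghost_wittMul f.constantCoeff_series g.constantCoeff_series r

lemma coeff_ghost_one (r : ℕ) : coeff r (ghost (1 : BigWitt A).series) = 1 := by
  have := coeff_ghost_one_sub one_ne_zero (1 : A) r
  simpa [series_one] using this

/-- The evaluation homomorphism from a torsion-free ring onto `A`. -/
noncomputable abbrev evalSelf (A : Type*) [CommRing A] : MvPolynomial A ℤ →+* A :=
  MvPolynomial.eval₂Hom (Int.castRingHom A) id

lemma mapFun_evalSelf_surjective : Function.Surjective (mapFun (evalSelf A)) :=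
  mapFun_surjective fun a => ⟨MvPolynomial.X a, by simp⟩

/-- The big Witt ring: `W(A) = 1 + T A[[T]]` with the multiplication of power series as addition
and the Witt multiplication, whose unit is `1 - T`. -/
noncomputable instance : CommRing (BigWitt A) where
  add_assoc f g h := BigWitt.ext (mul_assoc _ _ _)
  zero_add f := BigWitt.ext (one_mul _)
  add_zero f := BigWitt.ext (mul_one _)
  add_comm f g := BigWitt.ext (mul_comm _ _)
  neg_add_cancel f := BigWitt.ext ((mul_comm _ _).trans (mul_inv1 f.constantCoeff_series))
  nsmul := nsmulRec
  zsmul := zsmulRec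
  mul_assoc f g h := by
    obtain ⟨f, rfl⟩ := mapFun_evalSelf_surjective f
    obtain ⟨g, rfl⟩ := mapFun_evalSelf_surjective g
    obtain ⟨h, rfl⟩ := mapFun_evalSelf_surjective h
    simp only [← mapFun_mul]
    refine congrArg _ (ext_ghost fun r => ?_)
    simp only [coeff_ghost_mul, mul_assoc]
  mul_comm f g := by
    obtain ⟨f, rfl⟩ := mapFun_evalSelf_surjective f
    obtain ⟨g, rfl⟩ := mapFun_evalSelf_surjective g
    simp only [← mapFun_mul]
    refine congrArg _ (ext_ghost fun r => ?_)
    simp only [coeff_ghost_mul, mul_comm]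
  one_mul f := by
    obtain ⟨f, rfl⟩ := mapFun_evalSelf_surjective f
    simp only [← mapFun_mul, ← mapFun_one (evalSelf A)]
    refine congrArg _ (ext_ghost fun r => ?_)
    simp only [coeff_ghost_mul, coeff_ghost_one, one_mul]
  mul_one f := by
    obtain ⟨f, rfl⟩ := mapFun_evalSelf_surjective f
    simp only [← mapFun_mul, ← mapFun_one (evalSelf A)]
    refine congrArg _ (ext_ghost fun r => ?_)
    simp only [coeff_ghost_mul, coeff_ghost_one, mul_one]
  left_distrib f g h := by
    obtain ⟨f, rfl⟩ := mapFun_evalSelf_surjective f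
    obtain ⟨g, rfl⟩ := mapFun_evalSelf_surjective g
    obtain ⟨h, rfl⟩ := mapFun_evalSelf_surjective h
    simp only [← mapFun_mul, ← mapFun_add]
    refine congrArg _ (ext_ghost fun r => ?_)
    simp only [coeff_ghost_mul, coeff_ghost_add, mul_add]
  right_distrib f g h := by
    obtain ⟨f, rfl⟩ := mapFun_evalSelf_surjective f
    obtain ⟨g, rfl⟩ := mapFun_evalSelf_surjective g
    obtain ⟨h, rfl⟩ := mapFun_evalSelf_surjective h
    simp only [← mapFun_mul, ← mapFun_add]
    refine congrArg _ (ext_ghost fun r => ?_)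
    simp only [coeff_ghost_mul, coeff_ghost_add, add_mul]
  zero_mul f := by
    obtain ⟨f, rfl⟩ := mapFun_evalSelf_surjective f
    simp only [← mapFun_mul, ← mapFun_zero (evalSelf A)]
    refine congrArg _ (ext_ghost fun r => ?_)
    simp only [coeff_ghost_mul, series_zero, ghost_one, map_zero, zero_mul]
  mul_zero f := by
    obtain ⟨f, rfl⟩ := mapFun_evalSelf_surjective f
    simp only [← mapFun_mul, ← mapFun_zero (evalSelf A)]
    refine congrArg _ (ext_ghost fun r => ?_)
    simp only [coeff_ghost_mul, series_zero, ghost_one, map_zero, mul_zero]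

/-- Functoriality of the big Witt ring. -/
noncomputable def map (φ : A →+* B) : BigWitt A →+* BigWitt B where
  toFun := mapFun φ
  map_one' := mapFun_one φ
  map_mul' := mapFun_mul φ
  map_zero' := mapFun_zero φ
  map_add' := mapFun_add φ

lemma series_map (φ : A →+* B) (f : BigWitt A) :
    (map φ f).series = PowerSeries.map φ f.series := rfl

end Ring

/-! ### Rational Witt vectors and Hankel matrices -/

section Subsets

variable {A B : Type*} [CommRing A] [CommRing B]

/-- The set `W_rat(A)` of rational Witt vectors: the power series `P / Q` with polynomials `P, Q` of
constant coefficient `1`. -/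
def rat (A : Type*) [CommRing A] : Set (BigWitt A) :=
  {f | ∃ P Q : Polynomial A, P.coeff 0 = 1 ∧ Q.coeff 0 = 1 ∧
    f.series * (Q : PowerSeries A) = (P : PowerSeries A)}

/-- The infinite Hankel matrix `H(f) = (a_{i+j})_{i,j ≥ 0}` of `f = 1 + a₁ T + a₂ T² + ⋯`. -/
noncomputable def hankel (f : BigWitt A) : Matrix ℕ ℕ A := Matrix.of fun i j => coeff (i + j) f.series

/-- All `(r+1) × (r+1)`-minors of the Hankel matrix of `f` vanish, that is, `rk H(f) ≤ r`. -/
def HankelRankLE (f : BigWitt A) (r : ℕ) : Prop :=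
  ∀ I J : Fin (r + 1) ↪o ℕ, ((hankel f).submatrix I J).det = 0

/-- The set `W_J(A)` of all `f` in `W(A)` with `rk H(f) < ∞`. -/
def finiteRank (A : Type*) [CommRing A] : Set (BigWitt A) :=
  {f | ∃ r : ℕ, 1 ≤ r ∧ HankelRankLE f r}

lemma map_mem_rat (φ : A →+* B) {f : BigWitt A} (hf : f ∈ rat A) : map φ f ∈ rat B := by
  obtain ⟨P, Q, hP, hQ, h⟩ := hf
  refine ⟨P.map φ, Q.map φ, by simp [hP], by simp [hQ], ?_⟩
  rw [series_map, Polynomial.polynomial_map_coe, Polynomial.polynomial_map_coe, ← map_mul, h]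

lemma map_mem_finiteRank (φ : A →+* B) {f : BigWitt A} (hf : f ∈ finiteRank A) :
    map φ f ∈ finiteRank B := by
  obtain ⟨r, hr, h⟩ := hf
  refine ⟨r, hr, fun I J => ?_⟩
  have h1 : (hankel (map φ f)).submatrix I J = φ.mapMatrix ((hankel f).submatrix I J) := by
    ext i j
    simp [hankel, series_map]
  rw [h1, ← RingHom.map_det, h I J, map_zero]

end Subsets

/-! ### The presheaves -/

/-- The big Witt ring as a functor from commutative rings to commutative rings. -/
noncomputable def functor : CommRingCat.{u} ⥤ CommRingCat.{u} where
  obj A := CommRingCat.of (BigWitt A)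
  map φ := CommRingCat.ofHom (map φ.hom)
  map_id A := by
    ext f n
    simp [series_map]
  map_comp φ ψ := by
    ext f n
    simp [series_map]

/-- The presheaf of rings `W(𝒪) : X ↦ W(𝒪(X))`. -/
noncomputable def presheaf : Scheme.{u}ᵒᵖ ⥤ CommRingCat.{u} := Scheme.Γ ⋙ functor

/-- The subpresheaf `W_rat(𝒪) : X ↦ W_rat(𝒪(X))` of `W(𝒪)`. -/
noncomputable def ratPresheaf : Subfunctor (presheaf.{u} ⋙ forget CommRingCat.{u}) where
  obj X := rat (Scheme.Γ.obj X)
  map i _ hf := map_mem_rat (Scheme.Γ.map i).hom hf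

/-- The subpresheaf `W_J(𝒪) : X ↦ W_J(𝒪(X))` of `W(𝒪)`. -/
noncomputable def finiteRankPresheaf : Subfunctor (presheaf.{u} ⋙ forget CommRingCat.{u}) where
  obj X := finiteRank (Scheme.Γ.obj X)
  map i _ hf := map_mem_finiteRank (Scheme.Γ.map i).hom hf

/-- The sheaf condition of a presheaf `P` for the fpqc coverings `{Uᵢ → X}` in the category of
Noetherian affine schemes: the sequence `P(X) → ∏ P(Uᵢ) ⇉ ∏ P(Uᵢ ×_X Uⱼ)` is exact. The affine
scheme `Uᵢ ×_X Uⱼ` need not be Noetherian. -/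
def IsFpqcSheafOnNoethAff (P : Scheme.{u}ᵒᵖ ⥤ Type u) : Prop :=
  ∀ (X : Scheme.{u}) (ι : Type v) (U : ι → Scheme.{u}) (f : ∀ i, U i ⟶ X),
    IsAffine X → IsNoetherian X → (∀ i, IsAffine (U i)) → (∀ i, IsNoetherian (U i)) →
    Presieve.ofArrows U f ∈ Scheme.fpqcPrecoverage X →
    ∀ s : ∀ i, P.obj (op (U i)),
      (∀ i j, P.map (Limits.pullback.fst (f i) (f j)).op (s i) =
        P.map (Limits.pullback.snd (f i) (f j)).op (s j)) →
      ∃! t : P.obj (op X), ∀ i, P.map (f i).op t = s i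

end BigWitt

/-! Everything rests on two descriptions. A Witt vector is rational exactly when its coefficients
satisfy a linear recurrence (`mem_rat_iff`). Over a Noetherian ring it has finite Hankel rank
exactly when it becomes rational over Frac(A/p) for each of the finitely many minimal primes p
(`mem_finiteRank_iff_forall_minimalPrimes`). The second description combines Kronecker's theorem
over a field with the remark that minors of size s lying in a nilpotent ideal force the minors of
size ks to vanish for large k (`Matrix.det_submatrix_mem_pow`).

Rational vectors are differences, in the Witt group, of polynomials. Products of polynomials are
treated with universal coefficients over an algebraically closed field of characteristic 0, where
polynomials split into factors 1 - aT. So W_rat is a subring, and W_J is one too, as an intersection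
of preimages of such subrings.

For descent, 𝒪 is represented by the affine line, hence an fpqc sheaf, and W(𝒪) is glued
coefficientwise. It remains to test membership on a finite faithfully flat subfamily. For W_J
injectivity on sections suffices. For W_rat the coefficients of a recurrence of given order solve a
linear system, which is finite up to equivalence over a Noetherian ring, and solvability descends
along faithfully flat maps (`IsRecurrent.of_faithfullyFlat`).

Over a Noetherian domain, recurrences descend from the fraction field
(`IsRecurrent.of_fractionRing`). Over 𝔽₂[ε], every series 1 + ε(⋯) has finite rank, which gives
uncountably many, while pairs of polynomials are countable. -/

/-! ### Minors and powers of ideals -/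

namespace Matrix

variable {A : Type*} [CommRing A]

/-- A consequence of Laplace expansion along a block of columns. -/
lemma det_mem_mul {m n : Type*} [Fintype m] [Fintype n] [DecidableEq m] [DecidableEq n]
    (M : Matrix (m ⊕ n) (m ⊕ n) A) {𝔞 𝔟 : Ideal A}
    (ha : ∀ I : m → m ⊕ n, (M.submatrix I Sum.inl).det ∈ 𝔞)
    (hb : ∀ I : n → m ⊕ n, (M.submatrix I Sum.inr).det ∈ 𝔟) : M.det ∈ 𝔞 * 𝔟 := by
  classical
  -- Group the permutations by cosets of S_m × S_n. Each coset contributes, up to sign, one minor of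
  -- the left columns times the complementary minor of the right columns.
  rw [det_apply, ← Finset.sum_fiberwise (g := fun σ : Equiv.Perm (m ⊕ n) =>
    (QuotientGroup.mk σ : Equiv.Perm (m ⊕ n) ⧸ (Equiv.Perm.sumCongrHom m n).range))]
  refine Ideal.sum_mem _ fun q _ => ?_
  obtain ⟨τ, rfl⟩ := QuotientGroup.mk_surjective q
  have key : ∑ σ : Equiv.Perm (m ⊕ n) with (QuotientGroup.mk σ :
        Equiv.Perm (m ⊕ n) ⧸ (Equiv.Perm.sumCongrHom m n).range) = QuotientGroup.mk τ,
        Equiv.Perm.sign σ • ∏ i, M (σ i) i =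
      ∑ ρ : Equiv.Perm m × Equiv.Perm n,
        Equiv.Perm.sign (τ * Equiv.Perm.sumCongrHom m n ρ) •
          ∏ i, M ((τ * Equiv.Perm.sumCongrHom m n ρ) i) i := by
    symm
    refine Finset.sum_bij (fun ρ _ => τ * Equiv.Perm.sumCongrHom m n ρ) ?_ ?_ ?_ ?_
    · intro ρ _
      simp only [Finset.mem_filter, Finset.mem_univ, true_and]
      rw [eq_comm, QuotientGroup.eq]
      exact ⟨ρ, by simp⟩
    · intro ρ _ ρ' _ h
      exact Equiv.Perm.sumCongrHom_injective (mul_left_cancel h)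
    · intro σ hσ
      simp only [Finset.mem_filter, Finset.mem_univ, true_and] at hσ
      rw [eq_comm, QuotientGroup.eq] at hσ
      obtain ⟨ρ, hρ⟩ := hσ
      exact ⟨ρ, Finset.mem_univ _, by rw [hρ, mul_inv_cancel_left]⟩
    · intro ρ _
      rfl
  have hdet : ∑ ρ : Equiv.Perm m × Equiv.Perm n,
        Equiv.Perm.sign (τ * Equiv.Perm.sumCongrHom m n ρ) •
          ∏ i, M ((τ * Equiv.Perm.sumCongrHom m n ρ) i) i =
      Equiv.Perm.sign τ • ((M.submatrix (τ ∘ Sum.inl) Sum.inl).det *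
        (M.submatrix (τ ∘ Sum.inr) Sum.inr).det) := by
    rw [det_apply, det_apply, Finset.sum_mul_sum, ← Finset.sum_product', Finset.smul_sum]
    refine Finset.sum_congr rfl fun ρ _ => ?_
    simp only [map_mul, Equiv.Perm.sumCongrHom_apply, Equiv.Perm.sign_sumCongr,
      Fintype.prod_sum_type, Equiv.Perm.coe_mul, Function.comp_apply, Equiv.Perm.sumCongr_apply,
      Sum.map_inl, Sum.map_inr, submatrix_apply, Units.smul_def, zsmul_eq_mul, Units.val_mul,
      Int.cast_mul]
    ring
  rw [key, hdet, Units.smul_def]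
  exact Submodule.smul_of_tower_mem _ _ (Ideal.mul_mem_mul (ha _) (hb _))

variable {ι κ : Type*} (M : Matrix ι κ A)

lemma det_submatrix_mem_mul {𝔞 𝔟 : Ideal A} {s t : ℕ}
    (hs : ∀ (I : Fin s → ι) (J : Fin s → κ), (M.submatrix I J).det ∈ 𝔞)
    (ht : ∀ (I : Fin t → ι) (J : Fin t → κ), (M.submatrix I J).det ∈ 𝔟)
    (I : Fin (s + t) → ι) (J : Fin (s + t) → κ) : (M.submatrix I J).det ∈ 𝔞 * 𝔟 := by
  rw [← det_submatrix_equiv_self finSumFinEquiv]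
  exact det_mem_mul _ (fun _ => hs _ _) (fun _ => ht _ _)

/-- Each further block of `s` columns in the Laplace expansion contributes one more factor `𝔞`. For
nilpotent `𝔞` this turns vanishing modulo `𝔞` into vanishing of larger minors. -/
lemma det_submatrix_mem_pow {𝔞 : Ideal A} {s : ℕ}
    (hs : ∀ (I : Fin s → ι) (J : Fin s → κ), (M.submatrix I J).det ∈ 𝔞) (k : ℕ)
    (I : Fin (k * s) → ι) (J : Fin (k * s) → κ) : (M.submatrix I J).det ∈ 𝔞 ^ k := by
  suffices ∀ t, t = k * s → ∀ (I : Fin t → ι) (J : Fin t → κ),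
      (M.submatrix I J).det ∈ 𝔞 ^ k from this _ rfl I J
  clear I J
  induction k with
  | zero => simp
  | succ k ih =>
    rintro t rfl
    rw [Nat.succ_mul, pow_succ]
    exact det_submatrix_mem_mul M (ih _ rfl) hs

lemma det_submatrix_mem_of_le {𝔞 : Ideal A} {s t : ℕ} (hst : s ≤ t)
    (hs : ∀ (I : Fin s → ι) (J : Fin s → κ), (M.submatrix I J).det ∈ 𝔞)
    (I : Fin t → ι) (J : Fin t → κ) : (M.submatrix I J).det ∈ 𝔞 := by
  obtain ⟨t, rfl⟩ := Nat.exists_eq_add_of_le hst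
  simpa using det_submatrix_mem_mul M hs (𝔟 := ⊤) (fun _ _ => trivial) I J

end Matrix

namespace BigWitt

open PowerSeries

/-! ### Hankel rank and nilpotent kernels -/

section HankelRank

variable {A B : Type*} [CommRing A] [CommRing B]

/-- A repeated index gives equal rows or columns; otherwise sorting the indices only changes the
sign. Laplace expansion needs such unordered index maps. -/
lemma HankelRankLE.det_submatrix {f : BigWitt A} {r : ℕ} (h : HankelRankLE f r)
    (I J : Fin (r + 1) → ℕ) : ((hankel f).submatrix I J).det = 0 := by
  by_cases hI : Function.Injective I
  swap
  · obtain ⟨i, j, hij, hne⟩ := Function.not_injective_iff.mp hI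
    exact Matrix.det_zero_of_row_eq hne (by ext k; simp [hij])
  by_cases hJ : Function.Injective J
  swap
  · obtain ⟨i, j, hij, hne⟩ := Function.not_injective_iff.mp hJ
    exact Matrix.det_zero_of_column_eq hne (fun k => by simp [hij])
  have sorted {K : Fin (r + 1) → ℕ} (hK : Function.Injective K) :
      StrictMono (K ∘ Tuple.sort K) :=
    (Tuple.monotone_sort K).strictMono_of_injective (hK.comp (Tuple.sort K).injective)
  have h1 := h (OrderEmbedding.ofStrictMono _ (sorted hI))
    (OrderEmbedding.ofStrictMono _ (sorted hJ))
  have h2 : (hankel f).submatrix (OrderEmbedding.ofStrictMono _ (sorted hI))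
      (OrderEmbedding.ofStrictMono _ (sorted hJ)) =
      (((hankel f).submatrix I J).submatrix id (Tuple.sort J)).submatrix (Tuple.sort I) id := rfl
  rw [h2, Matrix.det_permute, Matrix.det_permute'] at h1
  simpa [Units.isUnit, ← Units.smul_def, ← zsmul_eq_mul, smul_eq_zero_iff_eq] using h1

lemma HankelRankLE.mono {f : BigWitt A} {r s : ℕ} (h : HankelRankLE f r) (hrs : r ≤ s) :
    HankelRankLE f s := fun I J =>
  Ideal.mem_bot.mp <| Matrix.det_submatrix_mem_of_le (hankel f) (by omega)
    (fun I J => Ideal.mem_bot.mpr (h.det_submatrix I J)) I J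

lemma mem_finiteRank_iff {f : BigWitt A} : f ∈ finiteRank A ↔ ∃ r, HankelRankLE f r :=
  ⟨fun ⟨r, _, h⟩ => ⟨r, h⟩, fun ⟨r, h⟩ => ⟨r + 1, by omega, h.mono (by omega)⟩⟩

lemma det_hankel_map (φ : A →+* B) (f : BigWitt A) {s : ℕ} (I J : Fin s → ℕ) :
    ((hankel (map φ f)).submatrix I J).det = φ ((hankel f).submatrix I J).det := by
  rw [RingHom.map_det]
  congr 1

/-- For a finite family of ring homomorphisms whose joint kernel is nilpotent, membership in
`W_J` may be tested after applying the homomorphisms. -/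
lemma mem_finiteRank_of_forall_map {ι : Type*} [Finite ι] {B : ι → Type*}
    [∀ i, CommRing (B i)] (φ : ∀ i, A →+* B i) (hφ : IsNilpotent (⨅ i, RingHom.ker (φ i)))
    {f : BigWitt A} (hf : ∀ i, map (φ i) f ∈ finiteRank (B i)) : f ∈ finiteRank A := by
  cases nonempty_fintype ι
  obtain ⟨k, hk⟩ := hφ
  choose r hr using fun i => mem_finiteRank_iff.mp (hf i)
  let s := Finset.univ.sup r
  have h1 : ∀ I J : Fin (s + 1) → ℕ,
      ((hankel f).submatrix I J).det ∈ ⨅ i, RingHom.ker (φ i) := by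
    intro I J
    rw [Submodule.mem_iInf]
    intro i
    rw [RingHom.mem_ker, ← det_hankel_map]
    exact ((hr i).mono (Finset.le_sup (f := r) (Finset.mem_univ i))).det_submatrix I J
  -- The minors of size `s + 1` lie in the joint kernel, so those of size `k * (s + 1)` lie in its
  -- `k`-th power, which is zero.
  refine mem_finiteRank_iff.mpr ⟨k * (s + 1), fun I J => ?_⟩
  refine Ideal.mem_bot.mp (Matrix.det_submatrix_mem_of_le (hankel f) (Nat.le_succ _) ?_ I J)
  intro I J
  rw [← Ideal.zero_eq_bot, ← hk]
  exact Matrix.det_submatrix_mem_pow _ h1 k I J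

end HankelRank

/-! ### Rational power series and linear recurrences -/

section Recurrence

variable {A B : Type*} [CommRing A] [CommRing B]

/-- The sequence `a` satisfies a linear recurrence of order `d`. -/
def IsRecurrent (a : ℕ → A) (d : ℕ) : Prop :=
  ∃ c : Fin d → A, ∀ n, a (n + d) = ∑ i, c i * a (n + i)

lemma IsRecurrent.succ {a : ℕ → A} {d : ℕ} (h : IsRecurrent a d) : IsRecurrent a (d + 1) := by
  obtain ⟨c, hc⟩ := h
  refine ⟨Fin.cons 0 c, fun n => ?_⟩
  rw [Fin.sum_univ_succ, ← add_assoc, add_right_comm, hc]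
  simp [add_assoc, add_comm 1]

/-- Allows finitely many recurrences to be given a common order. -/
lemma IsRecurrent.mono {a : ℕ → A} {d e : ℕ} (h : IsRecurrent a d) (hde : d ≤ e) :
    IsRecurrent a e := by
  induction e, hde using Nat.le_induction with
  | base => exact h
  | succ e _ ih => exact ih.succ

lemma coeff_add_mul_polynomial (f : A⟦X⟧) {Q : Polynomial A} {D : ℕ} (hQ : Q.natDegree ≤ D)
    (n : ℕ) : coeff (n + D) (f * (Q : A⟦X⟧)) =
      Q.coeff 0 * coeff (n + D) f + ∑ i : Fin D, Q.coeff (D - i) * coeff (n + i) f := by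
  have h1 : (Q : A⟦X⟧) = ∑ j ∈ Finset.range (D + 1), C (Q.coeff j) * X ^ j := by
    conv_lhs => rw [Q.as_sum_range' (D + 1) (by omega)]
    rw [← Polynomial.coeToPowerSeries.ringHom_apply, map_sum]
    refine Finset.sum_congr rfl fun j _ => ?_
    rw [Polynomial.coeToPowerSeries.ringHom_apply, ← Polynomial.C_mul_X_pow_eq_monomial]
    simp
  rw [h1, Finset.mul_sum, map_sum, Finset.sum_range_succ']
  have h2 (j : ℕ) (hj : j ≤ D) : coeff (n + D) (f * (C (Q.coeff j) * X ^ j)) =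
      Q.coeff j * coeff (n + (D - j)) f := by
    rw [mul_left_comm, coeff_C_mul, show n + D = n + (D - j) + j by omega, coeff_mul_X_pow]
  rw [h2 0 (Nat.zero_le _), Nat.sub_zero, add_comm, ← Finset.sum_range_reflect,
    Fin.sum_univ_eq_sum_range (fun i => Q.coeff (D - i) * coeff (n + i) f)]
  congr 1
  refine Finset.sum_congr rfl fun j hj => ?_
  rw [Finset.mem_range] at hj
  rw [h2 _ (by omega), show D - 1 - j + 1 = D - j by omega, show D - (D - j) = j by omega]

/-- Beyond the degree of `P`, the equation fQ = P is a recurrence whose coefficients are those of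
`-Q` in reverse order. Conversely a recurrence defines `Q`, and fQ is then a polynomial. -/
lemma mem_rat_iff {f : BigWitt A} :
    f ∈ rat A ↔ ∃ d, IsRecurrent (fun n => coeff n f.series) d := by
  constructor
  · rintro ⟨P, Q, hP, hQ, h⟩
    -- This order is at least the degree of `Q` and exceeds that of `P`, so the right-hand side
    -- vanishes for every `n`.
    refine ⟨P.natDegree + Q.natDegree + 1,
      fun i => -Q.coeff (P.natDegree + Q.natDegree + 1 - i), fun n => ?_⟩
    have h1 := coeff_add_mul_polynomial f.series
      (show Q.natDegree ≤ P.natDegree + Q.natDegree + 1 by omega) n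
    rw [h, Polynomial.coeff_coe, Polynomial.coeff_eq_zero_of_natDegree_lt (by omega), hQ,
      one_mul] at h1
    simp only [neg_mul, Finset.sum_neg_distrib]
    linear_combination -h1
  · rintro ⟨d, c, hc⟩
    let Q : Polynomial A := 1 - ∑ i : Fin d, Polynomial.C (c i) * Polynomial.X ^ (d - i : ℕ)
    have hQ0 : Q.coeff 0 = 1 := by
      simp only [Q, Polynomial.coeff_sub, Polynomial.coeff_one_zero, Polynomial.finsetSum_coeff,
        Polynomial.coeff_C_mul, Polynomial.coeff_X_pow]
      rw [Finset.sum_eq_zero, sub_zero]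
      intro i _
      rw [if_neg (by omega), mul_zero]
    have hQd : Q.natDegree ≤ d := by
      refine (Polynomial.natDegree_sub_le _ _).trans (max_le (by simp) ?_)
      refine Polynomial.natDegree_sum_le_of_forall_le _ _ fun i _ => ?_
      exact (Polynomial.natDegree_C_mul_X_pow_le _ _).trans (Nat.sub_le _ _)
    have hQc (i : Fin d) : Q.coeff (d - i) = -c i := by
      simp only [Q, Polynomial.coeff_sub, Polynomial.coeff_one, Polynomial.finsetSum_coeff,
        Polynomial.coeff_C_mul, Polynomial.coeff_X_pow]
      rw [if_neg (by omega), zero_sub, Finset.sum_eq_single i]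
      · simp
      · intro j _ hj
        rw [if_neg (by omega), mul_zero]
      · simp
    -- The coefficient in degree `d` already vanishes; truncating at `d + 1` keeps the constant
    -- coefficient when `d = 0`.
    refine ⟨trunc (d + 1) (f.series * (Q : A⟦X⟧)), Q, ?_, hQ0, ?_⟩
    · rw [coeff_trunc, if_pos (by omega), coeff_zero_eq_constantCoeff_apply, map_mul,
        f.constantCoeff_series, one_mul, ← coeff_zero_eq_constantCoeff_apply,
        Polynomial.coeff_coe, hQ0]
    · ext m
      rw [Polynomial.coeff_coe, coeff_trunc]
      split_ifs with hm
      · rfl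
      · obtain ⟨n, rfl⟩ := Nat.exists_eq_add_of_le' (show d ≤ m by omega)
        rw [coeff_add_mul_polynomial _ hQd, hQ0, one_mul,
          show coeff (n + d) f.series = _ from hc n]
        simp [hQc]

/-- Kronecker's theorem over a field. -/
lemma rat_eq_finiteRank_of_field (K : Type*) [Field K] : rat K = finiteRank K := by
  ext f
  rw [mem_rat_iff, mem_finiteRank_iff]
  constructor
  · rintro ⟨d, c, hc⟩
    refine ⟨d, fun I J => ?_⟩
    let E : LinearRecurrence K := ⟨d, c⟩
    -- The rows of the Hankel matrix are solutions of the recurrence, a space of dimension `d`, so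
    -- any `d + 1` of them are dependent.
    let w : Fin (d + 1) → E.solSpace := fun k =>
      ⟨fun n => coeff (I k + n) f.series, fun n => by
        simpa only [add_assoc] using hc (I k + n)⟩
    have hw : ¬ LinearIndependent K w := fun h => by
      have := Module.Finite.equiv E.toInit.symm
      have h1 := h.fintype_card_le_finrank
      rw [LinearEquiv.finrank_eq E.toInit] at h1
      simp [E] at h1
    rw [Fintype.not_linearIndependent_iff] at hw
    obtain ⟨g, hg, i, hi⟩ := hw
    rw [← Matrix.exists_vecMul_eq_zero_iff]
    refine ⟨g, fun h => hi (congrFun h i), ?_⟩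
    ext j
    have h2 := congrFun (congrArg Subtype.val hg) (J j)
    simpa [w, Matrix.vecMul, dotProduct, hankel] using h2
  · rintro ⟨r, hr⟩
    let a : ℕ → K := fun n => coeff n f.series
    -- Take the least `t` for which all minors on the first `t` rows vanish. It is positive because
    -- the empty determinant is 1.
    have hex : ∃ t, ∀ J : Fin t → ℕ,
        (Matrix.of fun i j : Fin t => a (i + J j)).det = 0 :=
      ⟨r + 1, fun J => hr.det_submatrix (fun i => i) J⟩
    classical
    obtain ⟨s, hs⟩ : ∃ s, Nat.find hex = s + 1 := Nat.exists_eq_succ_of_ne_zero fun h0 => by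
      have := Nat.find_spec hex
      rw [h0] at this
      simpa using this Fin.elim0
    have hmin := Nat.find_min hex (m := s) (by omega)
    have hspec := Nat.find_spec hex
    rw [hs] at hspec
    push Not at hmin
    obtain ⟨J, hJ⟩ := hmin
    -- Cofactors along the first column of the minor with columns `n, J`. They do not depend on `n`,
    -- so expanding gives a recurrence; its leading coefficient is, up to sign, the nonvanishing
    -- minor.
    let μ : Fin (s + 1) → K := fun i => (-1) ^ (i : ℕ) *
      (Matrix.of fun k j : Fin s => a (i.succAbove k + J j)).det
    have hμ : μ (Fin.last s) ≠ 0 := by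
      refine mul_ne_zero (pow_ne_zero _ (by simp)) ?_
      simpa using hJ
    have hsum (n : ℕ) : ∑ i, μ i * a (n + i) = 0 := by
      rw [← hspec (Fin.cons n J), Matrix.det_succ_column_zero]
      refine Finset.sum_congr rfl fun i _ => ?_
      have : (Matrix.of fun k j : Fin s => a (i.succAbove k + J j)) =
          (Matrix.of fun i j : Fin (s + 1) =>
            a (i + (Fin.cons n J : Fin (s + 1) → ℕ) j)).submatrix i.succAbove Fin.succ := by
        ext k j
        simp
      simp only [μ, this, Matrix.of_apply, Fin.cons_zero, add_comm n]
      ring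
    refine ⟨s, fun i => -μ i.castSucc / μ (Fin.last s), fun n => ?_⟩
    have h := hsum n
    rw [Fin.sum_univ_castSucc] at h
    simp only [Fin.val_castSucc, Fin.val_last] at h
    simp only [div_mul_eq_mul_div, ← Finset.sum_div, neg_mul, Finset.sum_neg_distrib]
    rw [eq_div_iff hμ]
    linear_combination h

end Recurrence

end BigWitt

namespace BigWitt

open PowerSeries

/-! ### Rational Witt vectors form a subring -/

section RatSubring

variable {A B : Type*} [CommRing A] [CommRing B]

/-- The Witt vector `1 - a T`. -/
noncomputable def linear (a : A) : BigWitt A := ⟨1 - C a * X, by simp⟩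

/-- The ghost components of 1 - aT are the powers of `a`, and over a torsion-free ring they
determine the Witt vector. -/
lemma linear_mul_linear [IsAddTorsionFree A] (a b : A) :
    linear a * linear b = linear (a * b) := by
  refine ext_ghost fun r => ?_
  have h (x : A) : coeff r (ghost (linear x).series) = x ^ (r + 1) := by
    simpa [linear] using coeff_ghost_one_sub one_ne_zero x r
  rw [coeff_ghost_mul, h, h, h, mul_pow]

/-- The additive submonoid of those Witt vectors that are polynomials. -/
noncomputable def polynomialSubmonoid (A : Type*) [CommRing A] : AddSubmonoid (BigWitt A) where
  carrier := {f | ∃ P : Polynomial A, f.series = P}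
  zero_mem' := ⟨1, by simp [series_zero]⟩
  add_mem' := by
    rintro f g ⟨P, hP⟩ ⟨Q, hQ⟩
    exact ⟨P * Q, by rw [series_add, hP, hQ, Polynomial.coe_mul]⟩

lemma mem_polynomialSubmonoid_iff {f : BigWitt A} :
    f ∈ polynomialSubmonoid A ↔ ∃ N, ∀ n, N ≤ n → coeff n f.series = 0 := by
  constructor
  · rintro ⟨P, hP⟩
    refine ⟨P.natDegree + 1, fun n hn => ?_⟩
    rw [hP, Polynomial.coeff_coe, Polynomial.coeff_eq_zero_of_natDegree_lt (by omega)]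
  · rintro ⟨N, hN⟩
    refine ⟨trunc N f.series, PowerSeries.ext fun n => ?_⟩
    rw [Polynomial.coeff_coe, coeff_trunc]
    split_ifs with h
    · rfl
    · exact hN n (by omega)

lemma map_mem_polynomialSubmonoid (φ : A →+* B) {f : BigWitt A}
    (hf : f ∈ polynomialSubmonoid A) : map φ f ∈ polynomialSubmonoid B := by
  rw [mem_polynomialSubmonoid_iff] at hf ⊢
  obtain ⟨N, hN⟩ := hf
  exact ⟨N, fun n hn => by rw [series_map, coeff_map, hN n hn, map_zero]⟩

lemma mem_polynomialSubmonoid_of_map {φ : A →+* B} (hφ : Function.Injective φ) {f : BigWitt A}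
    (hf : map φ f ∈ polynomialSubmonoid B) : f ∈ polynomialSubmonoid A := by
  rw [mem_polynomialSubmonoid_iff] at hf ⊢
  obtain ⟨N, hN⟩ := hf
  exact ⟨N, fun n hn => hφ (by rw [map_zero, ← hN n hn, series_map, coeff_map])⟩

/-- Coefficients lift to variables, except that 0 lifts to 0, which keeps the lift a polynomial. -/
lemma exists_lift_mem_polynomialSubmonoid {f : BigWitt A} (hf : f ∈ polynomialSubmonoid A) :
    ∃ g ∈ polynomialSubmonoid (MvPolynomial A ℤ), map (evalSelf A) g = f := by
  classical
  rw [mem_polynomialSubmonoid_iff] at hf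
  obtain ⟨N, hN⟩ := hf
  refine ⟨⟨PowerSeries.mk fun n => if n = 0 then 1 else if coeff n f.series = 0 then 0 else
    MvPolynomial.X (coeff n f.series), ?_⟩, ?_, BigWitt.ext (PowerSeries.ext fun n => ?_)⟩
  · rw [← coeff_zero_eq_constantCoeff_apply, coeff_mk, if_pos rfl]
  · rw [mem_polynomialSubmonoid_iff]
    refine ⟨N + 1, fun n hn => ?_⟩
    rw [coeff_mk, if_neg (by omega), if_pos (hN n (by omega))]
  · rw [series_map, coeff_map, coeff_mk]
    split_ifs with h1 h2
    · subst h1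
      rw [map_one, coeff_zero_eq_constantCoeff_apply, f.constantCoeff_series]
    · rw [map_zero, h2]
    · simp

/-- Over an algebraically closed field, a polynomial with constant coefficient `1` is a product of
factors `1 - a T`. -/
lemma polynomialSubmonoid_le_closure_linear (K : Type*) [Field K] [IsAlgClosed K] :
    polynomialSubmonoid K ≤ AddSubmonoid.closure (Set.range linear) := by
  suffices ∀ (n : ℕ) (P : Polynomial K) (f : BigWitt K), P.natDegree = n → f.series = P →
      f ∈ AddSubmonoid.closure (Set.range linear) by
    rintro f ⟨P, hP⟩
    exact this _ P f rfl hP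
  intro n
  induction n with
  | zero =>
    intro P f hn hf
    have h0 : P.coeff 0 = 1 := by
      rw [← Polynomial.coeff_coe, ← hf, coeff_zero_eq_constantCoeff_apply, f.constantCoeff_series]
    have : f = 0 := BigWitt.ext (by
      rw [hf, Polynomial.eq_C_of_natDegree_eq_zero hn, h0]
      simp [series_zero])
    rw [this]
    exact zero_mem _
  | succ n ih =>
    intro P f hn hf
    have h0 : P.coeff 0 = 1 := by
      rw [← Polynomial.coeff_coe, ← hf, coeff_zero_eq_constantCoeff_apply, f.constantCoeff_series]
    obtain ⟨r, hr⟩ := IsAlgClosed.exists_root P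
      (Polynomial.degree_ne_of_natDegree_ne (by rw [hn]; exact Nat.succ_ne_zero n))
    obtain ⟨Q, rfl⟩ := Polynomial.dvd_iff_isRoot.mpr hr
    have hQ : Q ≠ 0 := by rintro rfl; simp at h0
    have hc : -r * Q.coeff 0 = 1 := by simpa [Polynomial.mul_coeff_zero] using h0
    have hr0 : r ≠ 0 := by rintro rfl; simp at hc
    -- Since X - r = -r(1 - r⁻¹X), the scalar `-r` is moved into the cofactor to make its constant
    -- coefficient 1.
    let g : BigWitt K := ⟨((Polynomial.C (-r) * Q : Polynomial K) : K⟦X⟧), by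
      rw [← coeff_zero_eq_constantCoeff_apply, Polynomial.coeff_coe, Polynomial.coeff_C_mul, hc]⟩
    have hg : f = linear r⁻¹ + g := BigWitt.ext (by
      rw [hf, series_add]
      simp only [linear, g, Polynomial.coe_mul, Polynomial.coe_sub, Polynomial.coe_X,
        Polynomial.coe_C]
      have h1 : (C r⁻¹ : K⟦X⟧) * C r = 1 := by rw [← map_mul, inv_mul_cancel₀ hr0, map_one]
      rw [map_neg]
      linear_combination (-(Q : K⟦X⟧) * X) * h1)
    rw [hg]
    refine add_mem (AddSubmonoid.subset_closure ⟨_, rfl⟩)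
      (ih (Polynomial.C (-r) * Q) g ?_ rfl)
    rw [Polynomial.natDegree_mul (Polynomial.X_sub_C_ne_zero r) hQ,
      Polynomial.natDegree_X_sub_C] at hn
    rw [Polynomial.natDegree_C_mul (neg_ne_zero.mpr hr0)]
    omega

/-- Witt multiplication is biadditive, so only products of two factors 1 - aT matter. -/
lemma mul_mem_polynomialSubmonoid_of_isAlgClosed {K : Type*} [Field K] [IsAlgClosed K]
    [CharZero K] {f g : BigWitt K} (hf : f ∈ polynomialSubmonoid K)
    (hg : g ∈ polynomialSubmonoid K) : f * g ∈ polynomialSubmonoid K := by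
  have hlin (a : K) : linear a ∈ polynomialSubmonoid K :=
    ⟨1 - Polynomial.C a * Polynomial.X, by simp [linear]⟩
  replace hf := polynomialSubmonoid_le_closure_linear K hf
  replace hg := polynomialSubmonoid_le_closure_linear K hg
  induction hf, hg using AddSubmonoid.closure_induction₂ with
  | mem x y hx hy =>
    obtain ⟨a, rfl⟩ := hx
    obtain ⟨b, rfl⟩ := hy
    rw [linear_mul_linear]
    exact hlin _
  | zero_left x _ => rw [zero_mul]; exact zero_mem _
  | zero_right x _ => rw [mul_zero]; exact zero_mem _
  | add_left x y z _ _ _ hx hy => rw [add_mul]; exact add_mem hx hy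
  | add_right x y z _ _ _ hx hy => rw [mul_add]; exact add_mem hx hy

/-- The universal coefficient ring is a domain of characteristic 0. Polynomiality of the product is
proved over the algebraic closure of its fraction field, returns by injectivity, and specializes to
`A`. -/
lemma mul_mem_polynomialSubmonoid {f g : BigWitt A} (hf : f ∈ polynomialSubmonoid A)
    (hg : g ∈ polynomialSubmonoid A) : f * g ∈ polynomialSubmonoid A := by
  obtain ⟨f', hf', rfl⟩ := exists_lift_mem_polynomialSubmonoid hf
  obtain ⟨g', hg', rfl⟩ := exists_lift_mem_polynomialSubmonoid hg
  rw [← map_mul]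
  refine map_mem_polynomialSubmonoid _ ?_
  let F := FractionRing (MvPolynomial A ℤ)
  let ι : MvPolynomial A ℤ →+* AlgebraicClosure F :=
    (algebraMap F (AlgebraicClosure F)).comp (algebraMap _ F)
  have hι : Function.Injective ι :=
    (algebraMap F (AlgebraicClosure F)).injective.comp (IsFractionRing.injective _ F)
  have : CharZero (AlgebraicClosure F) := charZero_of_injective_ringHom hι
  refine mem_polynomialSubmonoid_of_map hι ?_
  rw [map_mul]
  exact mul_mem_polynomialSubmonoid_of_isAlgClosed (map_mem_polynomialSubmonoid ι hf')
    (map_mem_polynomialSubmonoid ι hg')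

/-- Witt addition multiplies series, so P / Q is the Witt difference of `P` and `Q`. This reduces
products of rational vectors to products of polynomials. -/
lemma mem_rat_iff_exists_sub {f : BigWitt A} :
    f ∈ rat A ↔ ∃ g ∈ polynomialSubmonoid A, ∃ h ∈ polynomialSubmonoid A, f = g - h := by
  constructor
  · rintro ⟨P, Q, hP, hQ, h⟩
    refine ⟨⟨P, ?_⟩, ⟨P, rfl⟩, ⟨Q, ?_⟩, ⟨Q, rfl⟩, eq_sub_of_add_eq (BigWitt.ext h)⟩
    · rwa [← coeff_zero_eq_constantCoeff_apply, Polynomial.coeff_coe]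
    · rwa [← coeff_zero_eq_constantCoeff_apply, Polynomial.coeff_coe]
  · rintro ⟨g, ⟨P, hP⟩, h, ⟨Q, hQ⟩, rfl⟩
    refine ⟨P, Q, ?_, ?_, ?_⟩
    · rw [← Polynomial.coeff_coe, ← hP, coeff_zero_eq_constantCoeff_apply, g.constantCoeff_series]
    · rw [← Polynomial.coeff_coe, ← hQ, coeff_zero_eq_constantCoeff_apply, h.constantCoeff_series]
    · rw [← hP, ← hQ, ← series_add, sub_add_cancel]

/-- The subring of rational Witt vectors. -/
noncomputable def ratSubring (A : Type*) [CommRing A] : Subring (BigWitt A) where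
  carrier := rat A
  zero_mem' := ⟨1, 1, by simp, by simp, by simp [series_zero]⟩
  one_mem' := ⟨1 - Polynomial.X, 1, by simp, by simp, by simp [series_one]⟩
  neg_mem' := by
    rintro f ⟨P, Q, hP, hQ, h⟩
    refine ⟨Q, P, hQ, hP, ?_⟩
    rw [← h, ← mul_assoc, mul_comm (-f).series, series_neg, mul_inv1 f.constantCoeff_series,
      one_mul]
  add_mem' := by
    rintro f g ⟨P, Q, hP, hQ, h⟩ ⟨P', Q', hP', hQ', h'⟩
    refine ⟨P * P', Q * Q', by simp [Polynomial.mul_coeff_zero, hP, hP'],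
      by simp [Polynomial.mul_coeff_zero, hQ, hQ'], ?_⟩
    rw [series_add, Polynomial.coe_mul, Polynomial.coe_mul, ← h, ← h']
    ring
  mul_mem' := by
    intro f g hf hg
    rw [mem_rat_iff_exists_sub] at hf hg ⊢
    obtain ⟨p, hp, q, hq, rfl⟩ := hf
    obtain ⟨p', hp', q', hq', rfl⟩ := hg
    exact ⟨p * p' + q * q', add_mem (mul_mem_polynomialSubmonoid hp hp')
      (mul_mem_polynomialSubmonoid hq hq'), p * q' + q * p',
      add_mem (mul_mem_polynomialSubmonoid hp hq') (mul_mem_polynomialSubmonoid hq hp'), by ring⟩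

lemma coe_ratSubring : (ratSubring A : Set (BigWitt A)) = rat A := rfl

end RatSubring

/-! ### Finite Hankel rank over Noetherian rings -/

/-- A sequence in a Noetherian module lies in the span of finitely many of its members. -/
lemma exists_forall_mem_span_range_fin {A V : Type*} [CommRing A] [AddCommGroup V] [Module A V]
    [IsNoetherian A V] (v : ℕ → V) :
    ∃ N, ∀ n, v n ∈ Submodule.span A (Set.range fun i : Fin N => v i) := by
  have hmono : Monotone fun N : ℕ => Submodule.span A (Set.range fun i : Fin N => v i) :=
    fun N N' h => Submodule.span_mono (by
      rintro _ ⟨i, rfl⟩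
      exact ⟨Fin.castLE h i, rfl⟩)
  obtain ⟨N, hN⟩ := monotone_stabilizes_iff_noetherian.mpr ‹_› ⟨_, hmono⟩
  refine ⟨N, fun n => ?_⟩
  have h1 : v n ∈ Submodule.span A (Set.range fun i : Fin (N + n + 1) => v i) :=
    Submodule.subset_span ⟨⟨n, by omega⟩, rfl⟩
  have h2 := hN (N + n + 1) (by omega)
  simp only [OrderHom.coe_mk] at h2
  rwa [h2]

section Noetherian

variable {A : Type*} [CommRing A] [IsNoetherianRing A]

/-- Over a Noetherian ring, `W_J` consists of the Witt vectors that become rational over the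
residue fields at the minimal primes. -/
lemma mem_finiteRank_iff_forall_minimalPrimes {f : BigWitt A} :
    f ∈ finiteRank A ↔
      ∀ p : minimalPrimes A, map (algebraMap A (FractionRing (A ⧸ p.1))) f ∈
        rat (FractionRing (A ⧸ p.1)) := by
  have (p : minimalPrimes A) : p.1.IsPrime := p.2.1.1
  constructor
  · intro hf p
    rw [rat_eq_finiteRank_of_field]
    exact map_mem_finiteRank _ hf
  · intro hf
    have : Finite (minimalPrimes A) := (minimalPrimes.finite_of_isNoetherianRing A).to_subtype
    refine mem_finiteRank_of_forall_map
      (fun p : minimalPrimes A => algebraMap A (FractionRing (A ⧸ p.1))) ?_ fun p => ?_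
    -- The joint kernel is the intersection of the minimal primes, that is, the nilradical, which is
    -- nilpotent in a Noetherian ring.
    · have h1 (p : minimalPrimes A) :
          RingHom.ker (algebraMap A (FractionRing (A ⧸ p.1))) = p.1 := by
        rw [IsScalarTower.algebraMap_eq A (A ⧸ p.1) (FractionRing (A ⧸ p.1)),
          ← RingHom.comap_ker, (RingHom.injective_iff_ker_eq_bot _).mp
            (IsFractionRing.injective (A ⧸ p.1) (FractionRing (A ⧸ p.1))),
          ← RingHom.ker_eq_comap_bot]
        exact Ideal.mk_ker
      simp only [h1]
      rw [← sInf_eq_iInf', minimalPrimes, Ideal.sInf_minimalPrimes]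
      exact IsNoetherianRing.isNilpotent_nilradical A
    · rw [← rat_eq_finiteRank_of_field]
      exact hf p

variable (A) in
/-- The subring of Witt vectors with Hankel matrix of finite rank. -/
noncomputable def finiteRankSubring : Subring (BigWitt A) :=
  ⨅ p : minimalPrimes A, (ratSubring _).comap (map (algebraMap A (FractionRing (A ⧸ p.1))))

lemma coe_finiteRankSubring : (finiteRankSubring A : Set (BigWitt A)) = finiteRank A := by
  ext f
  rw [mem_finiteRank_iff_forall_minimalPrimes]
  simp [finiteRankSubring, ← coe_ratSubring]

lemma rat_subset_finiteRank : rat A ⊆ finiteRank A := fun _ hf =>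
  mem_finiteRank_iff_forall_minimalPrimes.mpr fun _ => map_mem_rat _ hf

/-- A Noetherian domain is a Fatou ring: a sequence that is recurrent over the fraction field is
recurrent. -/
lemma IsRecurrent.of_fractionRing {K : Type*} [Field K] [Algebra A K] [FaithfulSMul A K]
    {a : ℕ → A} {d : ℕ} (h : IsRecurrent (fun n => algebraMap A K (a n)) d) :
    ∃ e, IsRecurrent a e := by
  obtain ⟨c, hc⟩ := h
  -- The windows of length `d` live in the Noetherian module A^d, so window `N` is an
  -- `A`-combination of earlier ones. These coefficients give the recurrence over `A`.
  obtain ⟨N, hN⟩ := exists_forall_mem_span_range_fin (A := A)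
    fun n => (fun k : Fin d => a (n + k))
  obtain ⟨b, hb⟩ := (Submodule.mem_span_range_iff_exists_fun A).mp (hN N)
  refine ⟨N, b, ?_⟩
  let E : LinearRecurrence K := ⟨d, c⟩
  have hshift (k : ℕ) : (fun n => algebraMap A K (a (n + k))) ∈ E.solSpace := fun n => by
    simpa only [add_right_comm _ k] using hc (n + k)
  have h1 : (fun n => algebraMap A K (a (n + N))) ∈ E.solSpace := hshift N
  have h2 : (∑ i, algebraMap A K (b i) • fun n => algebraMap A K (a (n + i))) ∈ E.solSpace :=
    Submodule.sum_mem _ fun i _ => Submodule.smul_mem _ _ (hshift i)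
  -- Both sides solve the recurrence over `K`, so agreement on the first `d` terms, which is the
  -- window relation, suffices.
  have h3 : (⟨_, h1⟩ : E.solSpace) = ⟨_, h2⟩ := E.toInit.injective (by
    ext k
    have h4 := congrArg (algebraMap A K) (congrFun hb k)
    simp only [Finset.sum_apply, Pi.smul_apply, smul_eq_mul, map_sum, map_mul] at h4
    simpa [LinearRecurrence.toInit, add_comm, Algebra.smul_def] using h4.symm)
  intro n
  have h5 := congrFun (congrArg Subtype.val h3) n
  refine FaithfulSMul.algebraMap_injective A K ?_
  simpa [Algebra.smul_def] using h5

lemma rat_eq_finiteRank_of_isDomain [IsDomain A] : rat A = finiteRank A := by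
  refine rat_subset_finiteRank.antisymm fun f hf => ?_
  have h1 := map_mem_finiteRank (algebraMap A (FractionRing A)) hf
  rw [← rat_eq_finiteRank_of_field, mem_rat_iff] at h1
  obtain ⟨d, hd⟩ := h1
  exact mem_rat_iff.mpr (IsRecurrent.of_fractionRing (K := FractionRing A) hd)

open TensorProduct in
/-- Faithfully flat descent for linear recurrences. -/
lemma IsRecurrent.of_faithfullyFlat {B : Type*} [CommRing B] [Algebra A B]
    [Module.FaithfullyFlat A B] {a : ℕ → A} {d : ℕ}
    (h : IsRecurrent (fun n => algebraMap A B (a n)) d) : IsRecurrent a d := by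
  obtain ⟨b, hb⟩ := h
  -- A recurrence of order `d` is a linear condition on windows of length `d + 1`, so it need only
  -- be checked for `n < N`.
  obtain ⟨N, hN⟩ := exists_forall_mem_span_range_fin (A := A)
    fun n => (fun k : Fin (d + 1) => a (n + k))
  let S : Submodule A (Fin N → A) :=
    Submodule.span A (Set.range fun i : Fin d => fun n : Fin N => a (n + i))
  let w : Fin N → A := fun n => a (n + d)
  -- The finite system is solvable exactly when the class of `w` modulo the span of the columns
  -- vanishes. This can be tested after tensoring with `B`, where `b` is a solution.
  have hw : S.mkQ w = 0 := by
    rw [← Module.FaithfullyFlat.one_tmul_eq_zero_iff A _ (A := B)]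
    have hsum (u : Fin N → A) : (1 : B) ⊗ₜ[A] S.mkQ u =
        ∑ n, algebraMap A B (u n) ⊗ₜ[A] S.mkQ (Pi.single n 1) := by
      conv_lhs => rw [pi_eq_sum_univ' u]
      rw [map_sum, tmul_sum]
      refine Finset.sum_congr rfl fun n _ => ?_
      rw [map_smul, tmul_smul, smul_tmul', Algebra.algebraMap_eq_smul_one]
    have hz (i : Fin d) : ∑ n : Fin N, algebraMap A B (a (n + i)) ⊗ₜ[A]
        S.mkQ (Pi.single n 1) = 0 := by
      rw [← hsum (fun n : Fin N => a (n + i)), Submodule.mkQ_apply,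
        (Submodule.Quotient.mk_eq_zero S).mpr, tmul_zero]
      exact Submodule.subset_span ⟨i, rfl⟩
    rw [hsum]
    simp only [w, hb, sum_tmul]
    rw [Finset.sum_comm]
    refine Finset.sum_eq_zero fun i _ => ?_
    simp only [← smul_eq_mul, ← smul_tmul', ← Finset.smul_sum]
    rw [hz, smul_zero]
  rw [Submodule.mkQ_apply, Submodule.Quotient.mk_eq_zero,
    Submodule.mem_span_range_iff_exists_fun] at hw
  obtain ⟨c, hc⟩ := hw
  refine ⟨c, fun n => ?_⟩
  -- This linear form measures the failure of the recurrence on a window. It kills the first `N`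
  -- windows, hence all of them.
  let ℓ : (Fin (d + 1) → A) →ₗ[A] A :=
    LinearMap.proj (Fin.last d) - ∑ i : Fin d, c i • LinearMap.proj i.castSucc
  have hℓ (n : ℕ) : ℓ (fun k => a (n + k)) = a (n + d) - ∑ i, c i * a (n + i) := by
    simp [ℓ]
  have hker : Submodule.span A (Set.range fun m : Fin N => fun k : Fin (d + 1) => a (m + k)) ≤
      LinearMap.ker ℓ := by
    rw [Submodule.span_le]
    rintro _ ⟨m, rfl⟩
    rw [SetLike.mem_coe, LinearMap.mem_ker, hℓ, sub_eq_zero]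
    have := congrFun hc m
    simpa [w] using this.symm
  have := hker (hN n)
  rwa [LinearMap.mem_ker, hℓ, sub_eq_zero] at this

end Noetherian

end BigWitt

namespace BigWitt

open PowerSeries

/-! ### Descent along faithfully flat finite families -/

section Descent

variable {A : Type*} [CommRing A] {ι : Type*} [Finite ι] {B : ι → Type*} [∀ i, CommRing (B i)]

/-- Recurrences over the factors, brought to a common order, are a single recurrence over the
product ring, and this one descends. -/
lemma mem_rat_of_forall_map [IsNoetherianRing A] {φ : ∀ i, A →+* B i}
    (hφ : (RingHom.pi φ).FaithfullyFlat) {f : BigWitt A}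
    (hf : ∀ i, map (φ i) f ∈ rat (B i)) : f ∈ rat A := by
  cases nonempty_fintype ι
  choose d hd using fun i => mem_rat_iff.mp (hf i)
  choose c hc using fun i => (hd i).mono (Finset.le_sup (f := d) (Finset.mem_univ i))
  let := (RingHom.pi φ).toAlgebra
  have : Module.FaithfullyFlat A (∀ i, B i) := hφ
  refine mem_rat_iff.mpr ⟨_, IsRecurrent.of_faithfullyFlat (B := ∀ i, B i)
    (d := Finset.univ.sup d) ⟨fun k i => c i k, fun n => funext fun i => ?_⟩⟩
  have := hc i n
  simp only [series_map, coeff_map] at this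
  exact this.trans (by simp [RingHom.algebraMap_toAlgebra])

lemma mem_finiteRank_of_forall_map_of_injective {φ : ∀ i, A →+* B i}
    (hφ : Function.Injective (RingHom.pi φ)) {f : BigWitt A}
    (hf : ∀ i, map (φ i) f ∈ finiteRank (B i)) : f ∈ finiteRank A := by
  refine mem_finiteRank_of_forall_map φ ?_ hf
  rw [show (⨅ i, RingHom.ker (φ i)) = ⊥ from ?_]
  · exact ⟨1, by simp⟩
  · refine (Submodule.eq_bot_iff _).mpr fun x hx => hφ ?_
    rw [map_zero]
    ext i
    exact (Submodule.mem_iInf _).mp hx i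

/-- A finite product of flat algebras is flat, and each prime of a factor pulls back to a prime of
the product with the same image in Spec A. -/
lemma faithfullyFlat_ringHom_pi {φ : ∀ i, A →+* B i} (hφ : ∀ i, (φ i).Flat)
    (hs : ∀ p : PrimeSpectrum A, ∃ i, ∃ q, PrimeSpectrum.comap (φ i) q = p) :
    (RingHom.pi φ).FaithfullyFlat := by
  classical
  cases nonempty_fintype ι
  let (i : ι) : Algebra A (B i) := (φ i).toAlgebra
  have (i : ι) : Module.Flat A (B i) := hφ i
  have : Module.Flat A (∀ i, B i) :=
    Module.Flat.of_linearEquiv (DFinsupp.linearEquivFunOnFintype (R := A) (M := B)).symm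
  have h1 : (RingHom.pi φ) = algebraMap A (∀ i, B i) := rfl
  rw [h1, RingHom.faithfullyFlat_algebraMap_iff]
  refine Module.FaithfullyFlat.of_comap_surjective fun p => ?_
  obtain ⟨i, q, rfl⟩ := hs p
  exact ⟨PrimeSpectrum.comap (Pi.evalRingHom B i) q, rfl⟩

end Descent

/-! ### Global sections as an fpqc sheaf -/

section Fpqc

variable {X : Scheme.{u}} {ι : Type v} {U : ι → Scheme.{u}} {f : ∀ i, U i ⟶ X}

/-- The polynomial ring in one variable over `ℤ`, in an arbitrary universe. -/
noncomputable abbrev polyInt : CommRingCat.{u} := CommRingCat.of (Polynomial (ULift.{u} ℤ))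

/-- The section classified by a morphism to the affine line. -/
noncomputable def sectionOfHom {Y : Scheme.{u}} (g : Y ⟶ Spec polyInt.{u}) : Γ(Y, ⊤) :=
  ((Scheme.ΓSpecIso polyInt.{u}).inv ≫ g.appTop).hom Polynomial.X

lemma sectionOfHom_bijective (Y : Scheme.{u}) : Function.Bijective (sectionOfHom (Y := Y)) := by
  have h (φ : polyInt.{u} ⟶ Γ(Y, ⊤)) :
      sectionOfHom (ΓSpec.adjunction.homEquiv Y (op polyInt.{u}) φ.op) = φ.hom Polynomial.X := by
    rw [sectionOfHom, ΓSpecIso_inv_ΓSpec_adjunction_homEquiv]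
  constructor
  · intro g g' hg
    obtain ⟨φ, rfl⟩ := (ΓSpec.adjunction.homEquiv Y (op polyInt.{u})).surjective g
    obtain ⟨φ', rfl⟩ := (ΓSpec.adjunction.homEquiv Y (op polyInt.{u})).surjective g'
    have h1 := (h φ.unop).symm.trans (hg.trans (h φ'.unop))
    have h2 : φ.unop = φ'.unop := by
      ext : 1
      refine Polynomial.ringHom_ext' ?_ h1
      refine RingHom.ext fun z => ?_
      have : z = ((z.down : ℤ) : ULift.{u} ℤ) := rfl
      rw [this, map_intCast, map_intCast]
    rw [← Quiver.Hom.op_unop φ, h2, Quiver.Hom.op_unop]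
  · intro a
    refine ⟨_, (h (CommRingCat.ofHom (Polynomial.eval₂RingHom
      ((Int.castRingHom _).comp (ULift.ringEquiv (R := ℤ)).toRingHom) a))).trans ?_⟩
    simp

lemma sectionOfHom_comp {Y Z : Scheme.{u}} (h : Y ⟶ Z) (g : Z ⟶ Spec polyInt.{u}) :
    sectionOfHom (h ≫ g) = h.appTop.hom (sectionOfHom g) := by
  rw [sectionOfHom, Scheme.Hom.comp_appTop, ← Category.assoc]
  rfl

/-- Sections are morphisms to the affine line, and the fpqc topology is subcanonical, so
representable presheaves are sheaves. -/
lemma existsUnique_section (hf : Presieve.ofArrows U f ∈ Scheme.fpqcPrecoverage X)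
    (s : ∀ i, Γ(U i, ⊤))
    (hs : ∀ i j, (Limits.pullback.fst (f i) (f j)).appTop.hom (s i) =
      (Limits.pullback.snd (f i) (f j)).appTop.hom (s j)) :
    ∃! t : Γ(X, ⊤), ∀ i, (f i).appTop.hom t = s i := by
  have h0 : Sieve.generate (Presieve.ofArrows U f) ∈ Scheme.fpqcTopology X :=
    Precoverage.generate_mem_toGrothendieck hf
  have h1 : Presieve.IsSheafFor (yoneda.obj (Spec polyInt.{u})) (Presieve.ofArrows U f) := by
    exact (GrothendieckTopology.Subcanonical.isSheaf_of_isRepresentable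
      (J := Scheme.fpqcTopology) _).isSheafFor _ h0
  rw [Presieve.isSheafFor_arrows_iff_pullbacks] at h1
  choose g hg using fun i => (sectionOfHom_bijective (U i)).2 (s i)
  obtain ⟨t, ht, huniq⟩ := h1 g fun i j => (sectionOfHom_bijective _).1 (by
    refine (sectionOfHom_comp _ _).trans (Eq.trans ?_ (sectionOfHom_comp _ _).symm)
    rw [hg, hg]
    exact hs i j)
  refine ⟨sectionOfHom t, fun i => ?_, fun t' ht' => ?_⟩
  · rw [← sectionOfHom_comp, ← hg]
    exact congrArg _ (ht i)
  · obtain ⟨t', rfl⟩ := (sectionOfHom_bijective X).2 t'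
    refine congrArg _ (huniq t' fun i => (sectionOfHom_bijective _).1 ?_)
    exact (sectionOfHom_comp _ _).trans ((ht' i).trans (hg i).symm)

/-- The presheaf `W(𝒪)` satisfies the sheaf condition for fpqc coverings. -/
lemma existsUnique_bigWitt (hf : Presieve.ofArrows U f ∈ Scheme.fpqcPrecoverage X)
    (s : ∀ i, BigWitt Γ(U i, ⊤))
    (hs : ∀ i j, map (Limits.pullback.fst (f i) (f j)).appTop.hom (s i) =
      map (Limits.pullback.snd (f i) (f j)).appTop.hom (s j)) :
    ∃! t : BigWitt Γ(X, ⊤), ∀ i, map (f i).appTop.hom t = s i := by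
  choose t ht huniq using fun n => existsUnique_section hf (fun i => coeff n (s i).series)
    fun i j => by
      rw [← coeff_map, ← coeff_map, ← series_map, ← series_map, hs]
  refine ⟨⟨PowerSeries.mk t, ?_⟩, fun i => ?_, fun t' ht' => ?_⟩
  · rw [← coeff_zero_eq_constantCoeff_apply, coeff_mk]
    -- The constant coefficients glue to 1 because 1 also restricts to them.
    refine (huniq 0 1 fun i => ?_).symm
    rw [map_one, coeff_zero_eq_constantCoeff_apply, (s i).constantCoeff_series]
  · refine BigWitt.ext (PowerSeries.ext fun n => ?_)
    rw [series_map, coeff_map, coeff_mk]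
    exact ht n i
  · refine BigWitt.ext (PowerSeries.ext fun n => ?_)
    rw [coeff_mk]
    refine huniq n _ fun i => ?_
    rw [← coeff_map, ← series_map, ht']

/-- An fpqc covering of affine schemes has a finite subfamily that is faithfully flat on global
sections. -/
lemma exists_fin_faithfullyFlat [IsAffine X] [∀ i, IsAffine (U i)]
    (hf : Presieve.ofArrows U f ∈ Scheme.fpqcPrecoverage X) :
    ∃ (n : ℕ) (j : Fin n → ι),
      (RingHom.pi fun k => (f (j k)).appTop.hom).FaithfullyFlat := by
  let E : PreZeroHypercover.{v} X := ⟨ι, U, f⟩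
  have hE : QuasiCompactCover E := Scheme.presieve₀_mem_qcPrecoverage_iff.mp hf.1
  have hflat : ∀ i, Flat (f i) := ((Scheme.ofArrows_mem_precoverage_iff _).mp hf.2).2
  -- Quasi-compactness applied to all of `X`: finitely many opens `V i` of members of the covering
  -- map onto `X`, hence so do the members themselves.
  obtain ⟨n, j, V, -, hV⟩ := QuasiCompactCover.exists_isAffineOpen_of_isCompact E
    (U := ⊤) isCompact_univ
  refine ⟨n, j, faithfullyFlat_ringHom_pi (fun k => ?_) fun p => ?_⟩
  · have := hflat (j k)
    exact HasRingHomProperty.appTop (P := @Flat) (f (j k)) this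
  · obtain ⟨x, hx⟩ : ∃ x, X.toSpecΓ x = p :=
      (X.toSpecΓ.homeomorph).surjective p
    have hx' : x ∈ ⋃ i, E.f (j i) '' (V i) := by rw [hV]; trivial
    obtain ⟨k, y, -, hy⟩ := Set.mem_iUnion.mp hx'
    refine ⟨k, (U (j k)).toSpecΓ y, ?_⟩
    change Spec.map (f (j k)).appTop ((U (j k)).toSpecΓ y) = p
    rw [← Scheme.Hom.comp_apply, ← Scheme.toSpecΓ_naturality, Scheme.Hom.comp_apply, ← hx]
    exact congrArg _ hy

lemma isNoetherianRing_sections (X : Scheme.{u}) [IsAffine X] [IsNoetherian X] :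
    IsNoetherianRing Γ(X, ⊤) :=
  IsLocallyNoetherian.component_noetherian ⟨⊤, isAffineOpen_top X⟩

/-- A subpresheaf of `W(𝒪)` whose membership may be tested on finite faithfully flat families is a
sheaf for fpqc coverings of Noetherian affine schemes. -/
lemma isFpqcSheafOnNoethAff_toFunctor
    (P : Subfunctor (presheaf.{u} ⋙ forget CommRingCat.{u}))
    (hP : ∀ (X : Scheme.{u}) (n : ℕ) (U : Fin n → Scheme.{u}) (f : ∀ i, U i ⟶ X),
      IsNoetherianRing Γ(X, ⊤) → (RingHom.pi fun k => (f k).appTop.hom).FaithfullyFlat →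
      ∀ t : BigWitt Γ(X, ⊤), (∀ k, map (f k).appTop.hom t ∈ P.obj (op (U k))) →
        t ∈ P.obj (op X)) :
    IsFpqcSheafOnNoethAff.{u, v} P.toFunctor := by
  intro X ι U f _ _ _ _ hf s hs
  obtain ⟨t, ht, huniq⟩ := existsUnique_bigWitt hf (fun i => (s i).1)
    fun i j => congrArg Subtype.val (hs i j)
  -- The glued `t` exists in W(𝒪); its membership in `P` is checked on a finite subfamily, without
  -- the fibre products.
  obtain ⟨n, j, hj⟩ := exists_fin_faithfullyFlat hf
  have htP : t ∈ P.obj (op X) := hP X n (fun k => U (j k)) (fun k => f (j k))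
    (isNoetherianRing_sections X) hj t fun k => by
      rw [ht]
      exact (s (j k)).2
  refine ⟨⟨t, htP⟩, fun i => Subtype.ext (ht i), fun t' ht' => Subtype.ext ?_⟩
  exact huniq t'.1 fun i => congrArg Subtype.val (ht' i)

lemma isFpqcSheafOnNoethAff_rat :
    IsFpqcSheafOnNoethAff.{u, v} ratPresheaf.{u}.toFunctor :=
  isFpqcSheafOnNoethAff_toFunctor _ fun _ _ _ _ _ hf _ ht => mem_rat_of_forall_map hf ht

lemma isFpqcSheafOnNoethAff_finiteRank :
    IsFpqcSheafOnNoethAff.{u, v} finiteRankPresheaf.{u}.toFunctor :=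
  isFpqcSheafOnNoethAff_toFunctor _ fun _ _ _ _ _ hf _ ht =>
    mem_finiteRank_of_forall_map_of_injective hf.injective ht

end Fpqc

/-! ### Countability -/

section Countability

variable {A : Type*} [CommRing A]

lemma countable_rat [Countable A] : (rat A).Countable := by
  classical
  have h : rat A ⊆ Set.range fun PQ : Polynomial A × Polynomial A =>
      -- The value 0 is a default for pairs whose quotient is not in W(A).
      if h : constantCoeff ((PQ.1 : A⟦X⟧) * inv1 (PQ.2 : A⟦X⟧)) = 1 then ⟨_, h⟩ else 0 := by
    rintro f ⟨P, Q, hP, hQ, h⟩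
    have hQ' : constantCoeff (Q : A⟦X⟧) = 1 := by
      rwa [← coeff_zero_eq_constantCoeff_apply, Polynomial.coeff_coe]
    have hf : f.series = (P : A⟦X⟧) * inv1 (Q : A⟦X⟧) := by
      rw [← h, mul_assoc, mul_inv1 hQ', mul_one]
    refine ⟨(P, Q), ?_⟩
    have h1 := f.constantCoeff_series
    rw [hf] at h1
    simp only [dif_pos h1]
    exact BigWitt.ext hf.symm
  have : Countable (Polynomial A) := by
    rw [← Cardinal.mk_le_aleph0_iff]
    exact Polynomial.cardinalMk_le_max.trans (max_le Cardinal.mk_le_aleph0 le_rfl)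
  exact (Set.countable_range _).mono h

/-- The Witt vector `1 + ∑ a_n T^(n+1)`. -/
noncomputable def ofTail (a : ℕ → A) : BigWitt A := ⟨1 + X * PowerSeries.mk a, by simp⟩

lemma ofTail_injective : Function.Injective (ofTail (A := A)) := by
  intro a b h
  have h1 := congrArg BigWitt.series h
  funext n
  have h2 := congrArg (coeff (n + 1)) h1
  simpa [ofTail, coeff_succ_X_mul, coeff_one] using h2

/-- In the presence of a nonzero element of square zero, `W_J` is uncountable. -/
lemma not_countable_finiteRank {ε : A} (hε : ε ≠ 0) (hε2 : ε * ε = 0) :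
    ¬ (finiteRank A).Countable := by
  intro hc
  -- One series 1 + ε ∑ T^(n+1), summed over n in `S`, for each set `S`. Modulo ε it becomes 1, of
  -- Hankel rank at most 1, and the kernel (ε) has square zero.
  let F : Set ℕ → BigWitt A := fun S => ofTail (S.indicator fun _ => ε)
  have hF : Function.Injective F := fun S S' h => by
    have h1 := ofTail_injective h
    ext n
    have h2 := congrFun h1 n
    by_cases hn : n ∈ S <;> by_cases hn' : n ∈ S' <;> simp_all
  have hmem (S : Set ℕ) : F S ∈ finiteRank A := by
    refine mem_finiteRank_of_forall_map (ι := Unit)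
      (fun _ => Ideal.Quotient.mk (Ideal.span {ε})) ⟨2, ?_⟩ fun _ => ?_
    · rw [ciInf_const, Ideal.mk_ker, Ideal.span_singleton_pow, pow_two, hε2]
      simp
    · have h0 : map (Ideal.Quotient.mk (Ideal.span {ε})) (F S) = 0 := by
        refine BigWitt.ext (PowerSeries.ext fun n => ?_)
        rw [series_map, coeff_map, series_zero]
        rcases n with _ | n
        · simp [F, ofTail]
        · have : Ideal.Quotient.mk (Ideal.span {ε}) ε = 0 :=
            Ideal.Quotient.eq_zero_iff_mem.mpr (Ideal.mem_span_singleton_self ε)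
          by_cases hn : n ∈ S <;> simp [F, ofTail, coeff_succ_X_mul, coeff_one, hn, this]
      rw [h0]
      refine mem_finiteRank_iff.mpr ⟨1, fun I J => ?_⟩
      rw [Matrix.det_fin_two]
      have hI : I 0 < I 1 := I.strictMono (by decide)
      have hJ : J 0 < J 1 := J.strictMono (by decide)
      simp only [hankel, Matrix.submatrix_apply, Matrix.of_apply, series_zero, coeff_one]
      rw [if_neg (show I 1 + J 1 ≠ 0 by omega), if_neg (show I 0 + J 1 ≠ 0 by omega)]
      simp
  have h1 : (F ⁻¹' finiteRank A).Countable := hc.preimage_of_injOn hF.injOn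
  rw [Set.eq_univ_of_forall (s := F ⁻¹' finiteRank A) hmem, Set.countable_univ_iff] at h1
  obtain ⟨g, hg⟩ := exists_surjective_nat (Set ℕ)
  exact Function.cantor_surjective g hg

end Countability

end BigWitt

theorem theoremt3p4 :
    -- on Noetherian affine schemes, both are presheaves of subrings of `W(𝒪)`, one inside the other
    (∀ X : Scheme.{u}, IsAffine X → IsNoetherian X →
      (∃ R : Subring (BigWitt.presheaf.obj (op X)),
        (R : Set (BigWitt.presheaf.obj (op X))) = BigWitt.ratPresheaf.obj (op X)) ∧
      (∃ R : Subring (BigWitt.presheaf.obj (op X)),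
        (R : Set (BigWitt.presheaf.obj (op X))) = BigWitt.finiteRankPresheaf.obj (op X)) ∧
      BigWitt.ratPresheaf.obj (op X) ⊆ BigWitt.finiteRankPresheaf.obj (op X)) ∧
    -- both satisfy the fpqc sheaf condition
    BigWitt.IsFpqcSheafOnNoethAff.{u, v} BigWitt.ratPresheaf.{u}.toFunctor ∧
    BigWitt.IsFpqcSheafOnNoethAff.{u, v} BigWitt.finiteRankPresheaf.{u}.toFunctor ∧
    -- they agree on integral schemes
    (∀ X : Scheme.{u}, IsAffine X → IsNoetherian X → IsIntegral X →
      BigWitt.ratPresheaf.obj (op X) = BigWitt.finiteRankPresheaf.obj (op X)) ∧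
    -- they differ for `Spec 𝔽₂[ε]`
    (BigWitt.ratPresheaf.obj (op (Spec (CommRingCat.of (DualNumber (ZMod 2))))) ≠
        BigWitt.finiteRankPresheaf.obj (op (Spec (CommRingCat.of (DualNumber (ZMod 2))))) ∧
      (BigWitt.ratPresheaf.obj (op (Spec (CommRingCat.of (DualNumber (ZMod 2)))))).Countable ∧
      ¬ (BigWitt.finiteRankPresheaf.obj
        (op (Spec (CommRingCat.of (DualNumber (ZMod 2)))))).Countable) := by
  refine ⟨fun X _ _ => ?_, BigWitt.isFpqcSheafOnNoethAff_rat,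
    BigWitt.isFpqcSheafOnNoethAff_finiteRank, fun X _ _ _ => ?_, ?_⟩
  · have := BigWitt.isNoetherianRing_sections X
    exact ⟨⟨BigWitt.ratSubring Γ(X, ⊤), rfl⟩,
      ⟨BigWitt.finiteRankSubring Γ(X, ⊤), BigWitt.coe_finiteRankSubring⟩,
      BigWitt.rat_subset_finiteRank (A := Γ(X, ⊤))⟩
  · have := BigWitt.isNoetherianRing_sections X
    exact BigWitt.rat_eq_finiteRank_of_isDomain (A := Γ(X, ⊤))
  -- Global sections of the spectrum are only isomorphic to 𝔽₂[ε], so countability and ε are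
  -- transported along `e`.
  · let e := (Scheme.ΓSpecIso (CommRingCat.of (DualNumber (ZMod 2)))).commRingCatIsoToRingEquiv
    have : Finite (DualNumber (ZMod 2)) := inferInstanceAs (Finite (ZMod 2 × ZMod 2))
    have : Countable Γ(Spec (CommRingCat.of (DualNumber (ZMod 2))), ⊤) := e.injective.countable
    have h1 := BigWitt.countable_rat
      (A := Γ(Spec (CommRingCat.of (DualNumber (ZMod 2))), ⊤))
    have hε : (DualNumber.eps : DualNumber (ZMod 2)) ≠ 0 := fun h => by
      simpa using congrArg TrivSqZeroExt.snd h
    have h2 := BigWitt.not_countable_finiteRank (ε := e.symm DualNumber.eps)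
      (fun h => hε ((map_eq_zero_iff e.symm e.symm.injective).mp h))
      (by rw [← map_mul, DualNumber.eps_mul_eps, map_zero])
    exact ⟨fun h => h2 ((congrArg Set.Countable h).mp h1), h1, h2⟩
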